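/- Let $q=p^{\ell}$ with $p$ prime, let $a=p^{h}$ with $1\le h\le \ell$, and let $\eta,\omega\in\mathbb{F}_{q^6}^*$ be elements whose multiplicative orders satisfy $\mathrm{ord}(\eta)\mid q^3+1$, $\mathrm{ord}(\omega)\mid q^2-q+1$ and $\gcd(\mathrm{ord}(\eta),\mathrm{ord}(\omega))=1$. Let $t_1,t_2,t_3$ be integers with $$0<t_1<q^2(q^2-1)(q^3+1)-q^3+2q^2-1,\qquad 0<t_2<q^3(q^2-1)-q,\qquad 0<t_3<q^3(q^2-1)-1,$$ and put $N_1=\min\{a-2,\,t_2,\,t_3\}$, $M_1=\min\{t_1,\ \mathrm{ord}(\eta)-2,\ \mathrm{ord}(\omega)-2\}$ and $$S=\max\{(a-2)(q^3+1)+t_1q,\ \ t_2(q^3+1)+(\mathrm{ord}(\eta)-2)q,\ \ t_3(q^3+1)+(\mathrm{ord}(\omega)-2)q\}.$$ Then there exists an $$[\,n:=q^8-q^6+q^5-q^3,\ (M_1+1)(N_1+1),\ \ge n-S;\ a-1,\ \mathrm{ord}(\eta)-1,\ \mathrm{ord}(\omega)-1\,]$$ recoverable code over $\mathbb{F}_{q^6}$.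 Here an $[n,k,\ge d;r_1,\dots,r_\delta]$ recoverable code over a field $K$ is a linear code $C\subseteq K^n$ of dimension $k$ all of whose nonzero codewords have Hamming weight at least $d$, with a generator matrix $G=(g_1,\dots,g_n)$ (its rows form a basis of $C$, its columns are the $g_i$) such that for every $1\le i\le n$ there are pairwise disjoint sets $R_1,\dots,R_\delta\subseteq\{1,\dots,n\}\setminus\{i\}$ with $\#R_j=r_j$ and $g_i\in\langle g_\ell : \ell\in R_j\rangle$ for each $1\le j\le\delta$. -/

import Mathlib

/-- `G` is a generator matrix of the linear code `C` of length `n`: its rows form a basis of `C`. -/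
def IsGeneratorMatrix {K : Type*} [Field K] {n k : ℕ}
    (G : Matrix (Fin k) (Fin n) K) (C : Submodule K (Fin n → K)) : Prop :=
  LinearIndependent K G.row ∧ Submodule.span K (Set.range G.row) = C

/-- The `i`-th coordinate of the code generated by `G` has locality `(r 0, …, r (δ - 1))`: there are
pairwise disjoint repair sets `R j`, not containing `i`, with `R j` of cardinality `r j` and with the
`i`-th column of `G` in the span of the columns of `G` indexed by `R j`, for each `j`. -/
def HasLocalityAt {K : Type*} [Field K] {n k δ : ℕ}
    (G : Matrix (Fin k) (Fin n) K) (i : Fin n) (r : Fin δ → ℕ) : Prop :=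
  ∃ R : Fin δ → Finset (Fin n),
    (∀ j₁ j₂ : Fin δ, j₁ ≠ j₂ → Disjoint (R j₁) (R j₂)) ∧
    ∀ j : Fin δ, i ∉ R j ∧ (R j).card = r j ∧
      G.col i ∈ Submodule.span K (G.col '' (R j : Set (Fin n)))

/-- `C` is an `[n, k, ≥ d; r 0, …, r (δ - 1)]` recoverable code over `K`: a linear code of length `n`
and dimension `k`, all of whose nonzero codewords have Hamming weight at least `d` (so its minimum
distance is at least `d`), and all of whose coordinates have locality `(r 0, …, r (δ - 1))`.
The parameters `k` and `d` are integers, so that no subtraction in them is truncated. -/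
def IsRecoverableCode {K : Type*} [Field K] [DecidableEq K] {n δ : ℕ}
    (C : Submodule K (Fin n → K)) (k d : ℤ) (r : Fin δ → ℕ) : Prop :=
  (Module.finrank K C : ℤ) = k ∧
  (∀ c ∈ C, c ≠ 0 → d ≤ (hammingNorm c : ℤ)) ∧
  ∃ (m : ℕ) (G : Matrix (Fin m) (Fin n) K),
    IsGeneratorMatrix G C ∧ ∀ i : Fin n, HasLocalityAt G i r

/-! Locality is nearly free. Four equal columns repair one another by singletons, seven columns on
an affine line repair one another by pairs, and repair sets can be padded to any sizes that leave
room in `n`. It remains to find columns in `K ^ k`, `k = (M₁ + 1)(N₁ + 1)`, arranged in such blocks,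
on which each nonzero functional has at most `S` zeros; no single curve is needed for this.

The two orders are coprime divisors of `q ^ 3 + 1`. If both are at least `M + 2`, then `(M + 2)(M +
3) ≤ q ^ 3 + 1`, so `M` is at most about `q ^ (3/2)`, while `S` is at least of order `max (a - 2) 1
* q ^ 3`. Thus `k` is small compared with `S`.

Reed–Solomon columns repeated `q ^ 2` times give at most `(k - 1) q ^ 2` zeros, which settles small
`k`. For larger `k` the blocks are random (`exists_forall_sum_weight_lt`). A functional has on
average about `n / q ^ 6 ≈ q ^ 2` zeros, and the Chernoff bound beats the union over `q ^ (6k)`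
functionals once `6k log q`, plus a term of order `q ^ 2 θ`, is below `S log θ`. For `a = 2` the
first repair set is a single column, so equal columns are used; for `a ≥ 3` lines are available. The
case `q = 3`, `k = 6` is handled separately by an explicit code on a quotient of the Hermitian
curve. -/

open Finset

/-! ### Codes from columns, and padded repair sets -/

/-- Columns `c i` such that every nonzero functional kills at most `S < n` of them generate a code
of full dimension and minimum distance at least `n - S`. -/
theorem exists_isRecoverableCode_of_columns {K : Type*} [Field K] [DecidableEq K] {n k δ : ℕ}
    (c : Fin n → Fin k → K) (S : ℤ) (hS : S < n)
    (hz : ∀ v : Fin k → K, v ≠ 0 → ((univ.filter fun i => v ⬝ᵥ c i = 0).card : ℤ) ≤ S)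
    (r : Fin δ → ℕ) (hr : ∀ i, HasLocalityAt (Matrix.of fun j i => c i j) i r) :
    ∃ C : Submodule K (Fin n → K), IsRecoverableCode C (k : ℤ) ((n : ℤ) - S) r := by
  set G : Matrix (Fin k) (Fin n) K := Matrix.of fun j i => c i j with hG
  have hval : ∀ v i, Matrix.vecMul v G i = v ⬝ᵥ c i := fun v i => rfl
  -- A functional killing every column would have `n > S` zeros.
  have hinj : Function.Injective G.vecMul := by
    have : Function.Injective G.vecMulLinear := by
      rw [← LinearMap.ker_eq_bot, LinearMap.ker_eq_bot']
      intro v hv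
      by_contra hne
      have h1 := hz v hne
      have h2 : (univ.filter fun i => v ⬝ᵥ c i = 0) = univ := by
        ext i
        simpa [hval] using congrFun hv i
      rw [h2, card_univ, Fintype.card_fin] at h1
      omega
    exact this
  have hli : LinearIndependent K G.row := Matrix.vecMul_injective_iff.mp hinj
  refine ⟨Submodule.span K (Set.range G.row), ?_, ?_, k, G, ⟨hli, rfl⟩, hr⟩
  · rw [finrank_span_eq_card hli, Fintype.card_fin]
  · intro x hx hx0
    rw [← range_vecMulLinear (R := K)] at hx
    obtain ⟨v, rfl⟩ := hx
    have hv : v ≠ 0 := by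
      rintro rfl
      exact hx0 (map_zero _)
    have h1 := hz v hv
    have h2 : (univ.filter fun i => v ⬝ᵥ c i = 0).card + hammingNorm (G.vecMulLinear v) = n := by
      have := card_filter_add_card_filter_not (s := (univ : Finset (Fin n)))
        (fun i => v ⬝ᵥ c i = 0)
      rw [card_univ, Fintype.card_fin] at this
      exact this
    omega

/-- Enlarging three disjoint repair sets to prescribed sizes. -/
theorem exists_disjoint_supersets_card_eq {ι : Type*} [Fintype ι] [DecidableEq ι] (i : ι)
    {A B C : Finset ι} {a b c : ℕ} (hA : i ∉ A) (hB : i ∉ B) (hC : i ∉ C)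
    (hAB : Disjoint A B) (hAC : Disjoint A C) (hBC : Disjoint B C)
    (ha : A.card ≤ a) (hb : B.card ≤ b) (hc : C.card ≤ c) (hn : a + b + c < Fintype.card ι) :
    ∃ A' B' C' : Finset ι, A ⊆ A' ∧ B ⊆ B' ∧ C ⊆ C' ∧ A'.card = a ∧ B'.card = b ∧ C'.card = c ∧
      i ∉ A' ∧ i ∉ B' ∧ i ∉ C' ∧ Disjoint A' B' ∧ Disjoint A' C' ∧ Disjoint B' C' := by
  have key : ∀ (X Y Z : Finset ι) (x : ℕ), i ∉ X → Disjoint X Y → Disjoint X Z → X.card ≤ x →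
      x + Y.card + Z.card < Fintype.card ι →
      ∃ X', X ⊆ X' ∧ X'.card = x ∧ i ∉ X' ∧ Disjoint X' Y ∧ Disjoint X' Z := by
    intro X Y Z x hX hXY hXZ hx hcard
    have hsub : X ⊆ (insert i (Y ∪ Z))ᶜ := by
      intro t ht
      rw [mem_compl, mem_insert, mem_union]
      rintro (rfl | h | h)
      · exact hX ht
      · exact disjoint_left.mp hXY ht h
      · exact disjoint_left.mp hXZ ht h
    have hle : x ≤ ((insert i (Y ∪ Z))ᶜ).card := by
      rw [card_compl]
      have h1 := card_insert_le i (Y ∪ Z)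
      have h2 := card_union_le Y Z
      omega
    obtain ⟨X', h1, h2, h3⟩ := exists_subsuperset_card_eq hsub hx hle
    refine ⟨X', h1, h3, fun h => ?_, disjoint_left.mpr fun t ht hy => ?_,
      disjoint_left.mpr fun t ht hy => ?_⟩
    · have := h2 h
      simp at this
    · have := h2 ht
      simp [hy] at this
    · have := h2 ht
      simp [hy] at this
  obtain ⟨A', hA1, hA2, hA3, hA4, hA5⟩ := key A B C a hA hAB hAC ha (by omega)
  obtain ⟨B', hB1, hB2, hB3, hB4, hB5⟩ := key B A' C b hB hA4.symm hBC hb (by omega)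
  obtain ⟨C', hC1, hC2, hC3, hC4, hC5⟩ := key C A' B' c hC hA5.symm hB5.symm hc (by omega)
  exact ⟨A', B', C', hA1, hB1, hC1, hA2, hB2, hC2, hA3, hB3, hC3, hB4.symm, hC4.symm, hC5.symm⟩

/-- Enlarging a repair set only enlarges its span, so small disjoint repair sets suffice and the
prescribed sizes matter only as upper bounds. -/
theorem hasLocalityAt_of_disjoint {K : Type*} [Field K] {n k : ℕ}
    (G : Matrix (Fin k) (Fin n) K) (i : Fin n) {A B C : Finset (Fin n)} {a b c : ℕ}
    (hA : i ∉ A) (hB : i ∉ B) (hC : i ∉ C)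
    (hAB : Disjoint A B) (hAC : Disjoint A C) (hBC : Disjoint B C)
    (ha : A.card ≤ a) (hb : B.card ≤ b) (hc : C.card ≤ c) (hn : a + b + c < n)
    (sA : G.col i ∈ Submodule.span K (G.col '' (A : Set (Fin n))))
    (sB : G.col i ∈ Submodule.span K (G.col '' (B : Set (Fin n))))
    (sC : G.col i ∈ Submodule.span K (G.col '' (C : Set (Fin n)))) :
    HasLocalityAt G i ![a, b, c] := by
  obtain ⟨A', B', C', hA', hB', hC', cA, cB, cC, iA, iB, iC, dAB, dAC, dBC⟩ :=
    exists_disjoint_supersets_card_eq i hA hB hC hAB hAC hBC ha hb hc (by simpa using hn)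
  have mono : ∀ {X Y : Finset (Fin n)}, X ⊆ Y →
      G.col i ∈ Submodule.span K (G.col '' (X : Set (Fin n))) →
      G.col i ∈ Submodule.span K (G.col '' (Y : Set (Fin n))) := fun h hx =>
    Submodule.span_mono (Set.image_mono (by exact_mod_cast h)) hx
  refine ⟨![A', B', C'], ?_, ?_⟩
  · intro j₁ j₂ hj
    fin_cases j₁ <;> fin_cases j₂ <;>
      first | exact absurd rfl hj | exact dAB | exact dAC | exact dBC | exact dAB.symm |
        exact dAC.symm | exact dBC.symm
  · intro j
    fin_cases j
    · exact ⟨iA, cA, mono hA' sA⟩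
    · exact ⟨iB, cB, mono hB' sB⟩
    · exact ⟨iC, cC, mono hC' sC⟩

/-- A column repeated at least four times has every locality `(a, b, c)` with positive entries. -/
theorem hasLocalityAt_of_repeated {K : Type*} [Field K] {n k : ℕ}
    (G : Matrix (Fin k) (Fin n) K) (f : Fin 4 → Fin n) (hf : Function.Injective f)
    (hG : ∀ j, G.col (f j) = G.col (f 0)) {a b c : ℕ} (ha : 1 ≤ a) (hb : 1 ≤ b) (hc : 1 ≤ c)
    (hn : a + b + c < n) : HasLocalityAt G (f 0) ![a, b, c] := by
  have hne : ∀ {x y : Fin 4}, x ≠ y → f x ≠ f y := fun h h' => h (hf h')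
  have hs : ∀ j, G.col (f 0) ∈ Submodule.span K (G.col '' (({f j} : Finset (Fin n)) : Set (Fin n))) :=
    fun j => Submodule.subset_span ⟨f j, by simp, hG j⟩
  apply hasLocalityAt_of_disjoint G (f 0) (A := {f 1}) (B := {f 2}) (C := {f 3}) (hn := hn) <;>
    first | exact hs _ | simpa using hne (by decide) | simpa

/-- Seven columns `u + λ v` with distinct `λ` repair each other in pairs. -/
theorem hasLocalityAt_of_line {K : Type*} [Field K] {n k : ℕ}
    (G : Matrix (Fin k) (Fin n) K) (f : Fin 7 → Fin n) (hf : Function.Injective f)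
    (u v : Fin k → K) (t : Fin 7 → K) (ht : Function.Injective t)
    (hG : ∀ j, G.col (f j) = u + t j • v) {a b c : ℕ} (ha : 2 ≤ a) (hb : 2 ≤ b) (hc : 2 ≤ c)
    (hn : a + b + c < n) : HasLocalityAt G (f 0) ![a, b, c] := by
  have hne : ∀ {x y : Fin 7}, x ≠ y → f x ≠ f y := fun h h' => h (hf h')
  have hs : ∀ x y : Fin 7, x ≠ y → G.col (f 0) ∈
      Submodule.span K (G.col '' (({f x, f y} : Finset (Fin n)) : Set (Fin n))) := by
    intro x y hxy
    have h0 : t y - t x ≠ 0 := sub_ne_zero.mpr fun h => hxy (ht h).symm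
    have hx : G.col (f x) ∈ G.col '' (({f x, f y} : Finset (Fin n)) : Set (Fin n)) :=
      ⟨f x, by simp, rfl⟩
    have hy : G.col (f y) ∈ G.col '' (({f x, f y} : Finset (Fin n)) : Set (Fin n)) :=
      ⟨f y, by simp, rfl⟩
    have : G.col (f 0) = ((t y - t 0) / (t y - t x)) • G.col (f x) +
        ((t 0 - t x) / (t y - t x)) • G.col (f y) := by
      rw [hG, hG, hG]
      ext l
      simp only [Pi.add_apply, Pi.smul_apply, smul_eq_mul]
      field_simp
      ring
    rw [this]
    exact Submodule.add_mem _ (Submodule.smul_mem _ _ (Submodule.subset_span hx))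
      (Submodule.smul_mem _ _ (Submodule.subset_span hy))
  have hcard : ∀ x y : Fin 7, ({f x, f y} : Finset (Fin n)).card ≤ 2 := fun x y => card_le_two
  have hmem : ∀ x y : Fin 7, 0 ≠ x → 0 ≠ y → f 0 ∉ ({f x, f y} : Finset (Fin n)) := by
    intro x y hx hy
    simp [hne hx, hne hy]
  have hdis : ∀ x y z w : Fin 7, x ≠ z → x ≠ w → y ≠ z → y ≠ w →
      Disjoint ({f x, f y} : Finset (Fin n)) {f z, f w} := by
    intro x y z w h1 h2 h3 h4
    simp [(hne h1).symm, (hne h2).symm, (hne h3).symm, (hne h4).symm]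
  exact hasLocalityAt_of_disjoint G (f 0) (A := {f 1, f 2}) (B := {f 3, f 4}) (C := {f 5, f 6})
    (hmem _ _ (by decide) (by decide)) (hmem _ _ (by decide) (by decide))
    (hmem _ _ (by decide) (by decide))
    (hdis _ _ _ _ (by decide) (by decide) (by decide) (by decide))
    (hdis _ _ _ _ (by decide) (by decide) (by decide) (by decide))
    (hdis _ _ _ _ (by decide) (by decide) (by decide) (by decide))
    ((hcard _ _).trans ha) ((hcard _ _).trans hb) ((hcard _ _).trans hc) hn
    (hs _ _ (by decide)) (hs _ _ (by decide)) (hs _ _ (by decide))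

/-! ### Codes assembled from blocks of columns -/

theorem exists_injective_fin_zero_eq {m s : ℕ} [NeZero m] (h : m ≤ s) (u : Fin s) :
    ∃ g : Fin m → Fin s, Function.Injective g ∧ g 0 = u :=
  ⟨fun j => Equiv.swap (Fin.castLE h 0) u (Fin.castLE h j),
    (Equiv.injective _).comp (Fin.castLE_injective h), Equiv.swap_apply_left _ _⟩

/-- The number of zeros of a family on `Fin n`, counted blockwise. -/
theorem card_zeros_eq_sum_blocks {K β : Type*} [Field K] [DecidableEq K] [Fintype β] {n s k : ℕ}
    (e : Fin n ≃ β × Fin s) (c : β × Fin s → Fin k → K) (v : Fin k → K) :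
    (univ.filter fun i => v ⬝ᵥ c (e i) = 0).card =
      ∑ b : β, (univ.filter fun j => v ⬝ᵥ c (b, j) = 0).card := by
  have : (univ.filter fun i => v ⬝ᵥ c (e i) = 0).card =
      (univ.filter fun x : β × Fin s => v ⬝ᵥ c x = 0).card :=
    card_equiv e (by simp)
  rw [this]
  simp only [card_filter]
  rw [Fintype.sum_prod_type]

/-- A code whose columns come in blocks of at least four equal columns. -/
theorem exists_isRecoverableCode_of_repeated {K β : Type*} [Field K] [DecidableEq K] [Fintype β]
    {n s k : ℕ} (hs : 4 ≤ s) (hcard : n = Fintype.card β * s) (c : β → Fin k → K) (S : ℤ)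
    (hS : S < n) (hz : ∀ v : Fin k → K, v ≠ 0 →
      (((univ.filter fun b => v ⬝ᵥ c b = 0).card * s : ℕ) : ℤ) ≤ S)
    {r₁ r₂ r₃ : ℕ} (h₁ : 1 ≤ r₁) (h₂ : 1 ≤ r₂) (h₃ : 1 ≤ r₃) (hr : r₁ + r₂ + r₃ < n) :
    ∃ C : Submodule K (Fin n → K), IsRecoverableCode C (k : ℤ) ((n : ℤ) - S) ![r₁, r₂, r₃] := by
  obtain ⟨e⟩ : Nonempty (Fin n ≃ β × Fin s) := ⟨Fintype.equivOfCardEq (by simp [hcard])⟩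
  refine exists_isRecoverableCode_of_columns (fun i => c (e i).1) S hS ?_ _ ?_
  · intro v hv
    refine le_trans (le_of_eq ?_) (hz v hv)
    rw [card_zeros_eq_sum_blocks e (fun x => c x.1) v]
    congr 1
    rw [card_filter, sum_mul]
    refine sum_congr rfl fun b _ => ?_
    by_cases hb : v ⬝ᵥ c b = 0 <;> simp [hb]
  · intro i
    obtain ⟨g, hg, hg0⟩ := exists_injective_fin_zero_eq hs (e i).2
    have h0 : e.symm ((e i).1, g 0) = i := by rw [hg0, e.symm_apply_eq]
    have := hasLocalityAt_of_repeated (Matrix.of fun j i => c (e i).1 j)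
      (fun j => e.symm ((e i).1, g j))
      (e.symm.injective.comp fun x y h => hg (Prod.mk.inj h).2)
      (fun j => by ext l; simp [Matrix.col]) h₁ h₂ h₃ hr
    simpa only [h0] using this

/-- A code whose columns come in blocks of at least seven columns on an affine line. -/
theorem exists_isRecoverableCode_of_lines {K β : Type*} [Field K] [DecidableEq K] [Fintype β]
    {n s k : ℕ} (hs : 7 ≤ s) (hcard : n = Fintype.card β * s) (u w : β → Fin k → K)
    (t : β → Fin s → K) (ht : ∀ b, Function.Injective (t b)) (S : ℤ) (hS : S < n)
    (hz : ∀ v : Fin k → K, v ≠ 0 → ((∑ b : β,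
      (univ.filter fun j => v ⬝ᵥ u b + t b j * (v ⬝ᵥ w b) = 0).card : ℕ) : ℤ) ≤ S)
    {r₁ r₂ r₃ : ℕ} (h₁ : 2 ≤ r₁) (h₂ : 2 ≤ r₂) (h₃ : 2 ≤ r₃) (hr : r₁ + r₂ + r₃ < n) :
    ∃ C : Submodule K (Fin n → K), IsRecoverableCode C (k : ℤ) ((n : ℤ) - S) ![r₁, r₂, r₃] := by
  obtain ⟨e⟩ : Nonempty (Fin n ≃ β × Fin s) := ⟨Fintype.equivOfCardEq (by simp [hcard])⟩
  refine exists_isRecoverableCode_of_columns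
    (fun i => u (e i).1 + t (e i).1 (e i).2 • w (e i).1) S hS ?_ _ ?_
  · intro v hv
    refine le_trans (le_of_eq ?_) (hz v hv)
    rw [card_zeros_eq_sum_blocks e (fun x => u x.1 + t x.1 x.2 • w x.1) v]
    simp only [dotProduct_add, dotProduct_smul, smul_eq_mul]
  · intro i
    obtain ⟨g, hg, hg0⟩ := exists_injective_fin_zero_eq hs (e i).2
    have h0 : e.symm ((e i).1, g 0) = i := by rw [hg0, e.symm_apply_eq]
    have := hasLocalityAt_of_line
      (Matrix.of fun j i => (u (e i).1 + t (e i).1 (e i).2 • w (e i).1) j)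
      (fun j => e.symm ((e i).1, g j))
      (e.symm.injective.comp fun x y h => hg (Prod.mk.inj h).2) (u (e i).1) (w (e i).1)
      (fun j => t (e i).1 (g j)) ((ht _).comp hg)
      (fun j => by ext l; simp [Matrix.col]) h₁ h₂ h₃ hr
    simpa only [h0] using this

/-- The zero code of length `n`. -/
theorem exists_isRecoverableCode_zero {K : Type*} [Field K] [DecidableEq K] {n : ℕ} (S : ℤ)
    (hS : S < n) {r₁ r₂ r₃ : ℕ} (hr : r₁ + r₂ + r₃ < n) :
    ∃ C : Submodule K (Fin n → K), IsRecoverableCode C 0 ((n : ℤ) - S) ![r₁, r₂, r₃] := by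
  refine exists_isRecoverableCode_of_columns (k := 0) (fun _ => 0) S hS
    (fun v hv => absurd (Subsingleton.elim _ _) hv) _ fun i => ?_
  have h0 : ∀ s : Submodule K (Fin 0 → K), ∀ x, x ∈ s := fun s x => by
    rw [Subsingleton.elim x 0]
    exact s.zero_mem
  exact hasLocalityAt_of_disjoint _ i (A := ∅) (B := ∅) (C := ∅) (by simp) (by simp) (by simp)
    (by simp) (by simp) (by simp) (by simp) (by simp) (by simp) hr (h0 _ _) (h0 _ _) (h0 _ _)

/-! ### Repeated Reed–Solomon codes -/

theorem card_filter_eval_eq_zero_le {K : Type*} [Field K] [DecidableEq K] (s : Finset K)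
    {f : Polynomial K} (hf : f ≠ 0) {d : ℕ} (hd : f.natDegree ≤ d) :
    (s.filter fun y => f.eval y = 0).card ≤ d := by
  refine (card_le_card (t := f.roots.toFinset) fun y hy => ?_).trans
    ((Multiset.toFinset_card_le _).trans ((Polynomial.card_roots' f).trans hd))
  rw [mem_filter] at hy
  simpa [hf] using hy.2

theorem dotProduct_pow_eq_eval_ofFn {K : Type*} [Field K] [DecidableEq K] {k : ℕ} (v : Fin k → K)
    (y : K) : v ⬝ᵥ (fun j : Fin k => y ^ (j : ℕ)) = (Polynomial.ofFn k v).eval y := by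
  rw [Polynomial.ofFn_eq_sum_monomial, Polynomial.eval_finsetSum]
  simp [dotProduct, Polynomial.eval_monomial]

theorem ofFn_ne_zero {K : Type*} [Field K] [DecidableEq K] {k : ℕ} {v : Fin k → K}
    (hv : v ≠ 0) : Polynomial.ofFn k v ≠ 0 := by
  intro h
  apply hv
  funext j
  have := Polynomial.ofFn_coeff_eq_val_of_lt v j.2
  rw [h] at this
  simpa using this.symm

/-- Repeated Reed–Solomon codes. -/
theorem exists_isRecoverableCode_reedSolomon {K : Type*} [Field K] [Fintype K] [DecidableEq K]
    {n m s k : ℕ} (hs : 4 ≤ s) (hn : n = m * s) (hm : m ≤ Fintype.card K) (S : ℤ) (hS : S < n)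
    (hk : ((k : ℤ) - 1) * s ≤ S) {r₁ r₂ r₃ : ℕ} (h₁ : 1 ≤ r₁) (h₂ : 1 ≤ r₂) (h₃ : 1 ≤ r₃)
    (hr : r₁ + r₂ + r₃ < n) :
    ∃ C : Submodule K (Fin n → K), IsRecoverableCode C (k : ℤ) ((n : ℤ) - S) ![r₁, r₂, r₃] := by
  obtain ⟨Y, -, hY⟩ := exists_subset_card_eq (s := (univ : Finset K)) (n := m)
    (by rwa [card_univ])
  refine exists_isRecoverableCode_of_repeated (β := Y) hs (by simp [hn, hY])
    (fun b j => (b : K) ^ (j : ℕ)) S hS (fun v hv => ?_) h₁ h₂ h₃ hr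
  have hk0 : 0 < k := by
    rcases Nat.eq_zero_or_pos k with rfl | h
    · exact absurd (Subsingleton.elim _ _) hv
    · exact h
  have h1 := card_filter_eval_eq_zero_le Y (ofFn_ne_zero hv) (d := k - 1)
    (Nat.le_sub_one_of_lt (Polynomial.ofFn_natDegree_lt hk0 v))
  have h2 : (univ.filter fun b : Y => v ⬝ᵥ (fun j : Fin k => (b : K) ^ (j : ℕ)) = 0).card =
      (Y.filter fun y => (Polynomial.ofFn k v).eval y = 0).card := by
    simp only [dotProduct_pow_eq_eval_ofFn]
    rw [← card_map (Function.Embedding.subtype _)]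
    congr 1
    ext y
    simp [and_comm]
  rw [h2]
  refine le_trans ?_ hk
  rw [Nat.cast_mul]
  have h3 : (((Y.filter fun y => (Polynomial.ofFn k v).eval y = 0).card : ℕ) : ℤ) ≤ (k : ℤ) - 1 := by
    omega
  exact mul_le_mul_of_nonneg_right h3 (by positivity)

/-! ### Random blocks -/

/-- All fibres of a surjective homomorphism have the same size, so a uniform element has a uniform
image. -/
theorem card_mul_sum_comp_surjective {U W : Type*} [AddGroup U] [Fintype U] [AddGroup W]
    [Fintype W] (φ : U →+ W) (hφ : Function.Surjective φ) (F : W → ℝ) :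
    (Fintype.card W : ℝ) * ∑ u, F (φ u) = Fintype.card U * ∑ m, F m := by
  classical
  have hfib : ∀ m, (univ.filter fun u => φ u = m).card = (univ.filter fun u => φ u = 0).card :=
    fun m => AddMonoidHom.card_fiber_eq_of_mem_range φ (hφ m) (hφ 0)
  have h1 : ∑ u, F (φ u) = (univ.filter fun u => φ u = 0).card * ∑ m, F m := by
    rw [← sum_fiberwise univ φ (fun u => F (φ u)), mul_sum]
    refine sum_congr rfl fun m _ => ?_
    rw [← hfib m, ← nsmul_eq_mul, ← sum_const]
    exact sum_congr rfl fun u hu => by rw [(mem_filter.mp hu).2]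
  have h2 : Fintype.card U = Fintype.card W * (univ.filter fun u => φ u = 0).card := by
    rw [← card_univ, card_eq_sum_card_fiberwise (f := φ) (t := univ) (by simp)]
    simp [hfib]
  rw [h1, h2]
  push_cast
  ring

/-- Chernoff and union bound: random blocks have small total weight under all tests at once. -/
theorem exists_forall_sum_weight_lt {U W P : Type*} [AddGroup U] [Fintype U] [AddGroup W]
    [Fintype W] (s : Finset P) (φ : P → U →+ W) (hφ : ∀ p ∈ s, Function.Surjective (φ p))
    (wt : W → ℕ) {θ : ℝ} (hθ : 1 ≤ θ) {N T : ℕ}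
    (h : (s.card : ℝ) * (∑ m, θ ^ wt m) ^ N < θ ^ T * (Fintype.card W : ℝ) ^ N) :
    ∃ w : Fin N → U, ∀ p ∈ s, ∑ b, wt (φ p (w b)) < T := by
  classical
  by_contra! hcon
  have hU : (0 : ℝ) < Fintype.card U := by exact_mod_cast Fintype.card_pos
  have hW : (0 : ℝ) < Fintype.card W := by exact_mod_cast Fintype.card_pos
  -- If each choice of blocks fails some test, that test alone contributes at least `θ ^ T` to the
  -- exponential moment.
  have h1 : (Fintype.card U : ℝ) ^ N * θ ^ T ≤
      ∑ w : Fin N → U, ∑ p ∈ s, ∏ b, θ ^ wt (φ p (w b)) := by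
    have : (Fintype.card U : ℝ) ^ N * θ ^ T = ∑ w : Fin N → U, θ ^ T := by simp
    rw [this]
    refine sum_le_sum fun w _ => ?_
    obtain ⟨p, hp, hT⟩ := hcon w
    refine le_trans ?_ (single_le_sum (f := fun p => ∏ b, θ ^ wt (φ p (w b)))
      (fun p _ => prod_nonneg fun b _ => by positivity) hp)
    simp only [prod_pow_eq_pow_sum]
    exact pow_le_pow_right₀ hθ hT
  -- Independence of the blocks: the moment of a fixed test is an `N`-th power.
  have h2 : ∀ p ∈ s, (Fintype.card W : ℝ) ^ N * ∑ w : Fin N → U, ∏ b, θ ^ wt (φ p (w b)) =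
      (Fintype.card U : ℝ) ^ N * (∑ m, θ ^ wt m) ^ N := by
    intro p hp
    rw [← Fintype.sum_pow (fun u => θ ^ wt (φ p u)), ← mul_pow, ← mul_pow]
    rw [card_mul_sum_comp_surjective (φ p) (hφ p hp) fun m => θ ^ wt m]
  have h3 : (Fintype.card W : ℝ) ^ N * ((Fintype.card U : ℝ) ^ N * θ ^ T) ≤
      (Fintype.card U : ℝ) ^ N * (s.card * (∑ m, θ ^ wt m) ^ N) := by
    calc _ ≤ (Fintype.card W : ℝ) ^ N * ∑ w : Fin N → U, ∑ p ∈ s, ∏ b, θ ^ wt (φ p (w b)) := by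
          gcongr
      _ = ∑ p ∈ s, (Fintype.card U : ℝ) ^ N * (∑ m, θ ^ wt m) ^ N := by
          rw [sum_comm, mul_sum]
          exact sum_congr rfl h2
      _ = _ := by
          rw [sum_const, nsmul_eq_mul]
          ring
  have h4 : (Fintype.card U : ℝ) ^ N * (s.card * (∑ m, θ ^ wt m) ^ N) <
      (Fintype.card U : ℝ) ^ N * (θ ^ T * (Fintype.card W : ℝ) ^ N) := by
    gcongr
  linarith

/-- Simultaneous evaluation of a functional at `r` vectors, as a function of these vectors. -/
def dotProductHom {K : Type*} [Field K] {k : ℕ} (r : ℕ) (v : Fin k → K) :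
    (Fin r → Fin k → K) →+ (Fin r → K) where
  toFun u j := v ⬝ᵥ u j
  map_zero' := by
    ext
    simp
  map_add' a b := by
    ext
    simp

theorem dotProductHom_surjective {K : Type*} [Field K] {k r : ℕ} {v : Fin k → K} (hv : v ≠ 0) :
    Function.Surjective (dotProductHom r v) := by
  obtain ⟨i, hi⟩ := Function.ne_iff.mp hv
  intro m
  refine ⟨fun j => Pi.single i ((v i)⁻¹ * m j), ?_⟩
  ext j
  have hi' : v i ≠ 0 := hi
  simp [dotProductHom, hi']

theorem one_add_div_pow_lt {x A B C : ℝ} {N : ℕ} (hx : 0 ≤ x) (hC : 0 < C)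
    (h : A * Real.exp (N * x) < B) (hA : 0 ≤ A) :
    A * (C * (1 + x)) ^ N < B * C ^ N := by
  have h1 : (1 + x) ^ N ≤ Real.exp (N * x) := by
    rw [Real.exp_nat_mul]
    have := Real.add_one_le_exp x
    gcongr
    linarith
  calc A * (C * (1 + x)) ^ N = A * (1 + x) ^ N * C ^ N := by rw [mul_pow]; ring
    _ ≤ A * Real.exp (N * x) * C ^ N := by gcongr
    _ < B * C ^ N := by gcongr

/-- Codes made of blocks of four equal random columns. -/
theorem exists_isRecoverableCode_random_repeated {K : Type*} [Field K] [Fintype K] [DecidableEq K]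
    {n N k T : ℕ} (hn : n = N * 4) (S : ℤ) (hS : S < n) {φ : ℝ} (hφ : 1 ≤ φ)
    (hT : 4 * ((T : ℤ) - 1) ≤ S)
    (h : (Fintype.card K : ℝ) ^ k * Real.exp (N * (φ / Fintype.card K)) < φ ^ T)
    {r₁ r₂ r₃ : ℕ} (h₁ : 1 ≤ r₁) (h₂ : 1 ≤ r₂) (h₃ : 1 ≤ r₃) (hr : r₁ + r₂ + r₃ < n) :
    ∃ C : Submodule K (Fin n → K), IsRecoverableCode C (k : ℤ) ((n : ℤ) - S) ![r₁, r₂, r₃] := by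
  have hQ : (0 : ℝ) < Fintype.card K := by exact_mod_cast Fintype.card_pos
  let wt : (Fin 1 → K) → ℕ := fun m => if m 0 = 0 then 1 else 0
  -- A functional vanishes on a random column with probability `1 / |K|`; the mean of `φ ^ wt` is
  -- therefore `1 + (φ - 1) / |K|`.
  have hsum : ∑ m, φ ^ wt m ≤ Fintype.card K * (1 + φ / Fintype.card K) := by
    have h1 : ∑ m, φ ^ wt m = ∑ x : K, φ ^ (if x = 0 then 1 else 0) :=
      Fintype.sum_equiv (Equiv.funUnique (Fin 1) K) _ _ fun m => rfl
    have h2 : ∑ x : K, φ ^ (if x = 0 then 1 else 0) ≤ ∑ x : K, (1 + if x = 0 then φ else 0) := by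
      refine sum_le_sum fun x _ => ?_
      by_cases hx : x = 0 <;> simp [hx]
    rw [h1]
    refine h2.trans (le_of_eq ?_)
    rw [sum_add_distrib]
    simp only [sum_const, card_univ, nsmul_eq_mul, mul_one, sum_ite_eq', mem_univ, if_true]
    field_simp
  obtain ⟨w, hw⟩ := exists_forall_sum_weight_lt (N := N) (T := T)
    (univ.filter fun v : Fin k → K => v ≠ 0) (dotProductHom 1)
    (fun v hv => dotProductHom_surjective (mem_filter.mp hv).2) wt hφ (by
      have hc : ((univ.filter fun v : Fin k → K => v ≠ 0).card : ℝ) ≤ (Fintype.card K : ℝ) ^ k := by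
        have := card_filter_le (univ : Finset (Fin k → K)) (fun v => v ≠ 0)
        rw [card_univ, Fintype.card_fun, Fintype.card_fin] at this
        exact_mod_cast this
      calc _ ≤ (Fintype.card K : ℝ) ^ k * (Fintype.card K * (1 + φ / Fintype.card K)) ^ N := by
            gcongr
        _ < _ := by
            simp only [Fintype.card_fun, Fintype.card_fin, pow_one]
            exact one_add_div_pow_lt (by positivity) hQ h (by positivity))
  refine exists_isRecoverableCode_of_repeated (β := Fin N) le_rfl (by simp [hn])
    (fun b => w b 0) S hS (fun v hv => ?_) h₁ h₂ h₃ hr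
  have h1 := hw v (by simpa using hv)
  have h2 : ∑ b, wt (dotProductHom 1 v (w b)) = (univ.filter fun b => v ⬝ᵥ w b 0 = 0).card := by
    rw [card_filter]
    rfl
  rw [h2] at h1
  push_cast
  omega

theorem card_filter_add_mul_eq_zero_le_one {K : Type*} [Field K] [DecidableEq K] {s : ℕ}
    {t : Fin s → K} (ht : Function.Injective t) {x y : K} (h : ¬(x = 0 ∧ y = 0)) :
    (univ.filter fun j => x + t j * y = 0).card ≤ 1 := by
  rw [card_le_one]
  intro i hi j hj
  simp only [mem_filter, mem_univ, true_and] at hi hj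
  have hy : y ≠ 0 := by
    rintro rfl
    exact h ⟨by simpa using hi, rfl⟩
  refine ht (mul_right_cancel₀ hy ?_)
  linear_combination hi - hj

/-- Codes made of blocks of eight columns on random affine lines. -/
theorem exists_isRecoverableCode_random_lines {K : Type*} [Field K] [Fintype K] [DecidableEq K]
    {n N k T : ℕ} (hn : n = N * 8) (hK : 8 ≤ Fintype.card K) (S : ℤ) (hS : S < n) {θ : ℝ}
    (hθ : 1 ≤ θ) (hT : (T : ℤ) - 1 ≤ S)
    (h : (Fintype.card K : ℝ) ^ k *
      Real.exp (N * (8 * θ / Fintype.card K + θ ^ 8 / (Fintype.card K : ℝ) ^ 2)) < θ ^ T)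
    {r₁ r₂ r₃ : ℕ} (h₁ : 2 ≤ r₁) (h₂ : 2 ≤ r₂) (h₃ : 2 ≤ r₃) (hr : r₁ + r₂ + r₃ < n) :
    ∃ C : Submodule K (Fin n → K), IsRecoverableCode C (k : ℤ) ((n : ℤ) - S) ![r₁, r₂, r₃] := by
  have hQ : (0 : ℝ) < Fintype.card K := by exact_mod_cast Fintype.card_pos
  obtain ⟨t⟩ : Nonempty (Fin 8 ↪ K) := Function.Embedding.nonempty_of_card_le (by simpa using hK)
  let wt : (Fin 2 → K) → ℕ := fun m => (univ.filter fun j => m 0 + t j * m 1 = 0).card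
  have hsum : ∑ m, θ ^ wt m ≤ (Fintype.card K : ℝ) ^ 2 *
      (1 + (8 * θ / Fintype.card K + θ ^ 8 / (Fintype.card K : ℝ) ^ 2)) := by
    have h1 : ∑ m, θ ^ wt m = ∑ x : K × K, θ ^ (univ.filter fun j => x.1 + t j * x.2 = 0).card :=
      Fintype.sum_equiv (finTwoArrowEquiv K) _ _ fun m => rfl
    -- A nonzero affine function vanishes at no more than one of the eight parameters, and each
    -- parameter is hit with probability `1 / |K|`. Only the zero pair, of probability `1 / |K| ^
    -- 2`, has weight eight.
    have h2 : ∀ x : K × K, θ ^ (univ.filter fun j => x.1 + t j * x.2 = 0).card ≤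
        1 + (∑ j, if x.1 = - (t j * x.2) then θ else 0) + if x = 0 then θ ^ 8 else 0 := by
      intro x
      have hnn : ∀ j, 0 ≤ if x.1 = - (t j * x.2) then θ else 0 := fun j => by
        split_ifs <;> linarith
      have hs0 := sum_nonneg fun j (_ : j ∈ univ) => hnn j
      by_cases hx : x = 0
      · have : (univ.filter fun j => x.1 + t j * x.2 = 0).card = 8 := by simp [hx]
        rw [this, if_pos hx]
        linarith
      · rw [if_neg hx, add_zero]
        have hle := card_filter_add_mul_eq_zero_le_one t.injective (x := x.1) (y := x.2)
          fun h => hx (Prod.ext h.1 h.2)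
        rcases Nat.le_one_iff_eq_zero_or_eq_one.mp hle with h0 | h0
        · rw [h0, pow_zero]
          linarith
        · rw [h0, pow_one]
          obtain ⟨j, hj⟩ := card_eq_one.mp h0
          have hj' : x.1 + t j * x.2 = 0 := by
            have : j ∈ univ.filter fun j => x.1 + t j * x.2 = 0 := by rw [hj]; simp
            simpa using this
          have := single_le_sum (fun j (_ : j ∈ univ) => hnn j) (mem_univ j)
          rw [if_pos (eq_neg_of_add_eq_zero_left hj')] at this
          linarith
    have h3 : ∀ j, ∑ x : K × K, (if x.1 = - (t j * x.2) then θ else 0) = Fintype.card K * θ := by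
      intro j
      rw [Fintype.sum_prod_type_right]
      simp
    rw [h1]
    refine (sum_le_sum fun x _ => h2 x).trans (le_of_eq ?_)
    rw [sum_add_distrib, sum_add_distrib, sum_comm]
    simp only [h3, sum_const, card_univ, nsmul_eq_mul, mul_one, sum_ite_eq', mem_univ, if_true,
      Fintype.card_prod, Fintype.card_fin]
    push_cast
    field_simp
    ring
  obtain ⟨w, hw⟩ := exists_forall_sum_weight_lt (N := N) (T := T)
    (univ.filter fun v : Fin k → K => v ≠ 0) (dotProductHom 2)
    (fun v hv => dotProductHom_surjective (mem_filter.mp hv).2) wt hθ (by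
      have hc : ((univ.filter fun v : Fin k → K => v ≠ 0).card : ℝ) ≤ (Fintype.card K : ℝ) ^ k := by
        have := card_filter_le (univ : Finset (Fin k → K)) (fun v => v ≠ 0)
        rw [card_univ, Fintype.card_fun, Fintype.card_fin] at this
        exact_mod_cast this
      calc _ ≤ (Fintype.card K : ℝ) ^ k * ((Fintype.card K : ℝ) ^ 2 *
              (1 + (8 * θ / Fintype.card K + θ ^ 8 / (Fintype.card K : ℝ) ^ 2))) ^ N := by
            gcongr
        _ < _ := by
            simp only [Fintype.card_fun, Fintype.card_fin, Nat.cast_pow]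
            exact one_add_div_pow_lt (by positivity) (by positivity) h (by positivity))
  refine exists_isRecoverableCode_of_lines (β := Fin N) (by norm_num) (by simp [hn])
    (fun b => w b 0) (fun b => w b 1) (fun _ => t) (fun _ => t.injective) S hS (fun v hv => ?_)
    h₁ h₂ h₃ hr
  have h1 := hw v (by simpa using hv)
  have h2 : ∑ b, wt (dotProductHom 2 v (w b)) =
      ∑ b, (univ.filter fun j => v ⬝ᵥ w b 0 + t j * (v ⬝ᵥ w b 1) = 0).card := rfl
  rw [h2] at h1
  omega

/-! ### A quotient of the Hermitian curve over the field with 729 elements -/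

theorem card_addSubgroup_le_of_eval_eq_zero {K : Type*} [Field K] [Fintype K] [DecidableEq K]
    {f : Polynomial K} (hf : f ≠ 0) {d : ℕ} (hd : f.natDegree ≤ d) (H : AddSubgroup K)
    (hH : ∀ x ∈ H, f.eval x = 0) : Nat.card H ≤ d := by
  classical
  refine le_trans ?_ (card_filter_eval_eq_zero_le univ hf hd)
  rw [← Nat.subtype_card (p := fun y => f.eval y = 0) (univ.filter fun y => f.eval y = 0) (by simp)]
  exact Nat.card_le_card_of_injective (fun x : H => (⟨x, hH x x.2⟩ : {y : K // f.eval y = 0}))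
    fun x y h => Subtype.ext (by simpa using h)

/-- Over the field with `3 ^ 6` elements there is an additive polynomial of degree nine all of whose
fibres over the values `y ^ 28` are full: the equation `y ^ 28 = L z` describes a quotient of the
Hermitian curve. -/
theorem exists_additive_polynomial_full_fibres {K : Type*} [Field K] [Fintype K] [DecidableEq K]
    (hK : Fintype.card K = 729) :
    ∃ (L : Polynomial K) (t : K → Fin 9 → K), L.natDegree = 9 ∧
      (∀ y, Function.Injective (t y)) ∧ ∀ y j, L.eval (t y j) = y ^ 28 := by
  have hchar : CharP K 3 := charP_of_card_eq_prime_pow (f := 6) (by rw [hK]; norm_num)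
  have hexp : ExpChar K 3 := .prime Nat.prime_three
  have hcK : Nat.card K = 729 := by rw [Nat.card_eq_fintype_card, hK]
  have hfrob : ∀ x : K, x ^ 729 = x := fun x => by rw [← hK]; exact FiniteField.pow_card x
  have h3 : ∀ x y : K, (x + y) ^ 3 = x ^ 3 + y ^ 3 := fun x y => add_pow_char x y 3
  have h9 : ∀ x y : K, (x + y) ^ 9 = x ^ 9 + y ^ 9 := fun x y => add_pow_char_pow x y 3 2
  have h27 : ∀ x y : K, (x + y) ^ 27 = x ^ 27 + y ^ 27 := fun x y => add_pow_char_pow x y 3 3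
  -- The trace to the field with 27 elements. Its kernel and image consist of roots of polynomials
  -- of degree 27 and their orders multiply to 729, so both have order 27.
  let T : K →+ K := AddMonoidHom.mk' (fun z => z ^ 27 + z) fun x y => by rw [h27]; ring
  have hT : ∀ z, T z = z ^ 27 + z := fun z => rfl
  have hprod : Nat.card T.ker * Nat.card T.range = 729 := by
    rw [← AddSubgroup.index_ker, AddSubgroup.card_mul_index, hcK]
  have hcomp : ∀ z, (T z) ^ 27 = T z := fun z => by
    rw [hT, h27, ← pow_mul]
    norm_num [hfrob]
    ring
  have hd1 : (Polynomial.X ^ 27 - Polynomial.X : Polynomial K).natDegree = 27 := by compute_degree!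
  have hd2 : (Polynomial.X ^ 27 + Polynomial.X : Polynomial K).natDegree = 27 := by compute_degree!
  have hn1 : (Polynomial.X ^ 27 - Polynomial.X : Polynomial K) ≠ 0 := fun h => by simp [h] at hd1
  have hn2 : (Polynomial.X ^ 27 + Polynomial.X : Polynomial K) ≠ 0 := fun h => by simp [h] at hd2
  have hrange : Nat.card T.range ≤ 27 := by
    refine card_addSubgroup_le_of_eval_eq_zero hn1 hd1.le T.range ?_
    rintro _ ⟨z, rfl⟩
    simp [hcomp]
  have hker : Nat.card T.ker ≤ 27 := by
    refine card_addSubgroup_le_of_eval_eq_zero hn2 hd2.le T.ker fun z hz => ?_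
    have : T z = 0 := hz
    simpa [hT] using this
  have hker' : Nat.card T.ker = 27 := by nlinarith
  have hrange' : Nat.card T.range = 27 := by nlinarith
  obtain ⟨α, hα, hα0⟩ : ∃ α : K, α ^ 27 + α = 0 ∧ α ≠ 0 := by
    have : Nontrivial T.ker := Finite.one_lt_card_iff_nontrivial.mp (by omega)
    obtain ⟨x, hx⟩ := exists_ne (0 : T.ker)
    exact ⟨x, x.2, fun h => hx (Subtype.ext h)⟩
  have hα26 : α ^ 26 = -1 := mul_right_cancel₀ hα0 (by linear_combination hα)
  -- `M` kills the line spanned by a trace-zero `α` over the prime field, so `T` factors as `L' ∘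
  -- M`; the coefficients of `L'` are found by division, and the last one matches because `α ^ 26 =
  -- -1`.
  let M : K →+ K := AddMonoidHom.mk' (fun z => z ^ 3 + -α ^ 2 * z) fun x y => by rw [h3]; ring
  have hM : ∀ z, M z = z ^ 3 + -α ^ 2 * z := fun z => rfl
  let L' : K →+ K := AddMonoidHom.mk' (fun u => u ^ 9 + α ^ 18 * u ^ 3 + α ^ 24 * u) fun x y => by
    rw [h9, h3]; ring
  have hL' : ∀ u, L' u = u ^ 9 + α ^ 18 * u ^ 3 + α ^ 24 * u := fun u => rfl
  have hLM : ∀ z, L' (M z) = T z := fun z => by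
    rw [hL', hM, hT, h9, h3]
    linear_combination (-z) * hα26
  let L : Polynomial K := Polynomial.X ^ 9 + Polynomial.C (α ^ 18) * Polynomial.X ^ 3 +
    Polynomial.C (α ^ 24) * Polynomial.X
  have hL : ∀ u, L.eval u = L' u := fun u => by simp [L, hL']
  have hLker : 9 ≤ Nat.card L'.ker := by
    let M' : T.ker →+ L'.ker := (M.comp T.ker.subtype).codRestrict L'.ker fun z => by
      change L' (M z) = 0
      rw [hLM]
      exact z.2
    have h1 : Nat.card M'.ker ≤ 3 := by
      have hd : (Polynomial.X ^ 3 + Polynomial.C (-α ^ 2) * Polynomial.X : Polynomial K).natDegree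
        = 3 := by compute_degree!
      refine le_trans (le_of_eq ?_)
        (card_addSubgroup_le_of_eval_eq_zero (fun h => by rw [h] at hd; simp at hd) hd.le (M'.ker.map T.ker.subtype) ?_)
      · exact (AddSubgroup.card_map_of_injective T.ker.subtype_injective).symm
      · rintro _ ⟨z, hz, rfl⟩
        have : M z = 0 := congrArg Subtype.val hz
        simpa [hM] using this
    have h2 : Nat.card M'.ker * Nat.card M'.range = 27 := by
      rw [← AddSubgroup.index_ker, AddSubgroup.card_mul_index, hker']
    have h3 : Nat.card M'.range ≤ Nat.card L'.ker :=
      Nat.card_le_card_of_injective _ M'.range.subtype_injective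
    nlinarith
  obtain ⟨κ⟩ : Nonempty (Fin 9 ↪ L'.ker) :=
    Function.Embedding.nonempty_of_card_le (by
      rw [Fintype.card_fin, ← Nat.card_eq_fintype_card]
      exact hLker)
  -- `y ^ 28` is the norm of `y` to the field with 27 elements, and that field is the whole image of
  -- the trace.
  have hsurj : ∀ y : K, ∃ z, T z = y ^ 28 := by
    intro y
    have hsub : (T.range : Set K) ⊆ {x : K | x ^ 27 = x} := by
      rintro _ ⟨z, rfl⟩
      exact hcomp z
    have hle : ({x : K | x ^ 27 = x} : Set K).ncard ≤ (T.range : Set K).ncard := by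
      have h1 : (T.range : Set K).ncard = 27 := by rw [← hrange']; rfl
      have h2 := card_filter_eval_eq_zero_le univ hn1 hd1.le
      rw [h1, Set.ncard_eq_toFinset_card']
      refine le_trans (card_le_card fun x hx => ?_) h2
      simpa [sub_eq_zero] using hx
    have heq := Set.eq_of_subset_of_ncard_le hsub hle
    have hy : y ^ 28 ∈ {x : K | x ^ 27 = x} := by
      change (y ^ 28) ^ 27 = y ^ 28
      calc (y ^ 28) ^ 27 = y ^ 729 * y ^ 27 := by ring
        _ = y ^ 28 := by rw [hfrob]; ring
    rw [← heq] at hy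
    exact hy
  choose z hz using hsurj
  refine ⟨L, fun y j => M (z y) + κ j, by simp only [L]; compute_degree!, fun y i j h => ?_,
    fun y j => ?_⟩
  · exact κ.injective (Subtype.ext (add_left_cancel h))
  · rw [hL, map_add, hLM, hz, show L' (κ j) = 0 from (κ j).2, add_zero]

/-- On the curve `y ^ 28 = L z` the functions `y` and `z` have poles of order 9 and 28 at infinity,
so a combination of `1, y, …, y ^ 4, z` has at most 36 zeros. Repeated Reed–Solomon columns would
allow `5 * 9 = 45`, too many when `S = 43`. -/
theorem exists_isRecoverableCode_hermitian_quotient {K : Type*} [Field K] [Fintype K]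
    [DecidableEq K] (hK : Fintype.card K = 729) {n : ℕ} (hn : n = 6048) (S : ℤ) (hS : S < n)
    (hS' : 36 ≤ S) {r₁ r₂ r₃ : ℕ} (h₁ : 2 ≤ r₁) (h₂ : 2 ≤ r₂) (h₃ : 2 ≤ r₃)
    (hr : r₁ + r₂ + r₃ < n) :
    ∃ C : Submodule K (Fin n → K),
      IsRecoverableCode C ((6 : ℕ) : ℤ) ((n : ℤ) - S) ![r₁, r₂, r₃] := by
  obtain ⟨L, t, hLd, ht, hLt⟩ := exists_additive_polynomial_full_fibres hK
  obtain ⟨Y, -, hY⟩ := exists_subset_card_eq (s := (univ : Finset K)) (n := 672)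
    (by rw [card_univ, hK]; norm_num)
  -- The columns are `(1, y, …, y ^ 4, z)`. For fixed `y` the nine values of `z` put them on a line,
  -- and `672 * 9 = 6048`.
  refine exists_isRecoverableCode_of_lines (β := Y) (s := 9) (by norm_num) (by simp [hn, hY])
    (fun b => Fin.snoc (fun j : Fin 5 => (b : K) ^ (j : ℕ)) 0)
    (fun _ => Fin.snoc 0 1) (fun b => t b) (fun b => ht b) S hS (fun v hv => ?_) h₁ h₂ h₃ hr
  refine le_trans ?_ hS'
  set f := Polynomial.ofFn 5 (fun j : Fin 5 => v j.castSucc) with hf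
  set c := v (Fin.last 5) with hc
  have hu : ∀ y : K, v ⬝ᵥ (Fin.snoc (fun j : Fin 5 => y ^ (j : ℕ)) 0 : Fin 6 → K) = f.eval y := by
    intro y
    rw [hf, ← dotProduct_pow_eq_eval_ofFn]
    rw [dotProduct, Fin.sum_univ_castSucc]
    simp only [Fin.snoc_castSucc, Fin.snoc_last, mul_zero, add_zero]
    rfl
  have hw : v ⬝ᵥ (Fin.snoc (0 : Fin 5 → K) 1 : Fin 6 → K) = c := by
    rw [dotProduct, Fin.sum_univ_castSucc]
    simp only [Fin.snoc_castSucc, Fin.snoc_last, Pi.zero_apply, mul_zero, sum_const_zero, zero_add,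
      mul_one, hc]
  have hfd : f.natDegree ≤ 4 :=
    Nat.le_of_lt_succ (Polynomial.ofFn_natDegree_lt (by norm_num) _)
  simp only [hu, hw]
  rw [univ_eq_attach, sum_attach Y (fun y => (univ.filter fun j => f.eval y + t y j * c = 0).card)]
  suffices h : ∑ y ∈ Y, (univ.filter fun j => f.eval y + t y j * c = 0).card ≤ 36 by
    exact_mod_cast h
  by_cases hc0 : c = 0
  · have hf0 : f ≠ 0 := by
      refine ofFn_ne_zero fun h => hv ?_
      funext j
      induction j using Fin.lastCases with
      | last => exact hc0
      | cast j => exact congrFun h j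
    have h1 := card_filter_eval_eq_zero_le Y hf0 hfd
    calc _ = ∑ y ∈ Y, if f.eval y = 0 then 9 else 0 := by
          refine sum_congr rfl fun y _ => ?_
          by_cases hy : f.eval y = 0 <;> simp [hc0, hy]
      _ = (Y.filter fun y => f.eval y = 0).card * 9 := by
          rw [← sum_filter, sum_const, smul_eq_mul]
      _ ≤ 36 := by omega
  -- Eliminating `z` from `f y + c z = 0` leaves `g y = 0`. The polynomial `g` is nonzero because 9
  -- does not divide 28.
  · set g := L.comp (Polynomial.C (-c⁻¹) * f) - Polynomial.X ^ 28 with hg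
    have hcd : (L.comp (Polynomial.C (-c⁻¹) * f)).natDegree = 9 * f.natDegree := by
      rw [Polynomial.natDegree_comp, hLd, Polynomial.natDegree_C_mul (by simpa using hc0)]
    have hg0 : g ≠ 0 := by
      intro h
      have := congrArg Polynomial.natDegree (sub_eq_zero.mp h)
      rw [hcd, Polynomial.natDegree_X_pow] at this
      omega
    have hgd : g.natDegree ≤ 36 := by
      refine (Polynomial.natDegree_sub_le _ _).trans ?_
      rw [hcd, Polynomial.natDegree_X_pow]
      omega
    refine le_trans ?_ (card_filter_eval_eq_zero_le Y hg0 hgd)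
    rw [card_filter]
    refine sum_le_sum fun y _ => ?_
    by_cases hy : g.eval y = 0
    · rw [if_pos hy]
      exact card_filter_add_mul_eq_zero_le_one (ht y) fun h => hc0 h.2
    · rw [if_neg hy, Nat.le_zero, card_eq_zero, filter_eq_empty_iff]
      intro j _ hj
      apply hy
      have : -c⁻¹ * f.eval y = t y j := by
        field_simp
        linear_combination -hj
      rw [hg, Polynomial.eval_sub, Polynomial.eval_comp, Polynomial.eval_mul, Polynomial.eval_C,
        this, hLt, Polynomial.eval_pow, Polynomial.eval_X, sub_self]

/-! ### Estimates for the length `q ^ 8 - q ^ 6 + q ^ 5 - q ^ 3` -/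

/-- Lets blocks of four or eight columns fill the length exactly. -/
theorem eight_dvd_length {n q : ℕ}
    (hn : (n : ℤ) = (q : ℤ) ^ 8 - (q : ℤ) ^ 6 + (q : ℤ) ^ 5 - (q : ℤ) ^ 3) : 8 ∣ n := by
  suffices h : (8 : ℤ) ∣ n by exact_mod_cast h
  rw [hn]
  have h1 : (q : ℤ) ^ 8 - (q : ℤ) ^ 6 + (q : ℤ) ^ 5 - (q : ℤ) ^ 3 =
      (q : ℤ) ^ 3 * ((q : ℤ) ^ 2 - 1) * ((q : ℤ) ^ 3 + 1) := by ring
  rw [h1]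
  refine Dvd.dvd.mul_right ?_ _
  rcases Int.even_or_odd (q : ℤ) with ⟨m, hm⟩ | hodd
  · exact Dvd.dvd.mul_right ⟨m ^ 3, by rw [hm]; ring⟩ _
  · exact Dvd.dvd.mul_left (Int.eight_dvd_sq_sub_one_of_odd hodd) _

section

variable {K : Type*} [Field K] [Fintype K] [DecidableEq K] {n q k : ℕ}

theorem length_le_pow_eight (hq : 2 ≤ q)
    (hn : (n : ℤ) = (q : ℤ) ^ 8 - (q : ℤ) ^ 6 + (q : ℤ) ^ 5 - (q : ℤ) ^ 3) : n ≤ q ^ 8 := by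
  have h1 : (q : ℤ) ^ 5 ≤ (q : ℤ) ^ 6 := pow_le_pow_right₀ (by omega) (by norm_num)
  have h2 : (0 : ℤ) ≤ (q : ℤ) ^ 3 := by positivity
  have : (n : ℤ) ≤ (q : ℤ) ^ 8 := by linarith
  exact_mod_cast this

theorem exists_isRecoverableCode_of_sub_one_mul_le (hq : 2 ≤ q) (hK : Fintype.card K = q ^ 6)
    (hn : (n : ℤ) = (q : ℤ) ^ 8 - (q : ℤ) ^ 6 + (q : ℤ) ^ 5 - (q : ℤ) ^ 3)
    (S : ℤ) (hS : S < n) (hk : ((k : ℤ) - 1) * (q : ℤ) ^ 2 ≤ S)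
    {r₁ r₂ r₃ : ℕ} (h₁ : 1 ≤ r₁) (h₂ : 1 ≤ r₂) (h₃ : 1 ≤ r₃) (hr : r₁ + r₂ + r₃ < n) :
    ∃ C : Submodule K (Fin n → K), IsRecoverableCode C (k : ℤ) ((n : ℤ) - S) ![r₁, r₂, r₃] := by
  have hq2 : 1 ≤ q ^ 2 := Nat.one_le_pow _ _ (by omega)
  -- With multiplicity `q ^ 2` the number of distinct points is `q ^ 6 - q ^ 4 + q ^ 3 - q`, which
  -- fits into `K`.
  refine exists_isRecoverableCode_reedSolomon (m := q * (q ^ 3 + 1) * (q ^ 2 - 1)) (s := q ^ 2)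
    (by nlinarith) ?_ ?_ S hS (by exact_mod_cast hk) h₁ h₂ h₃ hr
  · zify [hq2]
    rw [hn]
    ring
  · rw [hK]
    zify [hq2]
    have h1 : (q : ℤ) ^ 3 ≤ (q : ℤ) ^ 4 := pow_le_pow_right₀ (by omega) (by norm_num)
    have h2 : (0 : ℤ) ≤ (q : ℤ) := by positivity
    linarith [show (q : ℤ) * (q ^ 3 + 1) * (q ^ 2 - 1) = q ^ 6 - q ^ 4 + q ^ 3 - q by ring]

theorem pow_mul_exp_lt_pow {Q k T : ℕ} (hQ : 0 < Q) {E θ : ℝ} (hθ : 0 < θ)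
    (h : k * Real.log Q + E < T * Real.log θ) : (Q : ℝ) ^ k * Real.exp E < θ ^ T := by
  have hQ' : (0 : ℝ) < Q := by exact_mod_cast hQ
  rw [← Real.log_lt_log_iff (by positivity) (by positivity),
    Real.log_mul (by positivity) (by positivity), Real.log_exp, Real.log_pow, Real.log_pow]
  exact h

/-- The Chernoff condition in logarithms: as `n ≤ q ^ 8`, the mean number of vanishing blocks of
four is at most `q ^ 2 / 4`. -/
theorem exists_isRecoverableCode_of_log_lt_of_one_le (hq : 2 ≤ q) (hK : Fintype.card K = q ^ 6)
    (hn : (n : ℤ) = (q : ℤ) ^ 8 - (q : ℤ) ^ 6 + (q : ℤ) ^ 5 - (q : ℤ) ^ 3)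
    (S : ℤ) (hS : S < n) {φ : ℝ} {T : ℕ} (hφ : 1 ≤ φ) (hT : 4 * ((T : ℤ) - 1) ≤ S)
    (h : 6 * k * Real.log q + (q : ℝ) ^ 2 * φ / 4 < T * Real.log φ)
    {r₁ r₂ r₃ : ℕ} (h₁ : 1 ≤ r₁) (h₂ : 1 ≤ r₂) (h₃ : 1 ≤ r₃) (hr : r₁ + r₂ + r₃ < n) :
    ∃ C : Submodule K (Fin n → K), IsRecoverableCode C (k : ℤ) ((n : ℤ) - S) ![r₁, r₂, r₃] := by
  obtain ⟨N, hN⟩ := eight_dvd_length hn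
  have hle : ((8 * N : ℕ) : ℝ) ≤ (q : ℝ) ^ 8 := by
    rw [← hN]
    exact_mod_cast length_le_pow_eight hq hn
  push_cast at hle
  have hq0 : (0 : ℝ) < q := by exact_mod_cast (by omega : 0 < q)
  refine exists_isRecoverableCode_random_repeated (N := 2 * N) (by omega) S hS hφ hT
    (pow_mul_exp_lt_pow Fintype.card_pos (by linarith) (lt_of_le_of_lt ?_ h)) h₁ h₂ h₃ hr
  have h1 : ((2 * N : ℕ) : ℝ) * (φ / Fintype.card K) ≤ (q : ℝ) ^ 2 * φ / 4 := by
    rw [hK]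
    push_cast
    rw [mul_div_assoc', div_le_iff₀ (by positivity)]
    nlinarith
  have h2 : (k : ℝ) * Real.log (Fintype.card K) = 6 * k * Real.log q := by
    rw [hK]
    push_cast
    rw [Real.log_pow]
    push_cast
    ring
  linarith

theorem exists_isRecoverableCode_of_log_lt_of_two_le (hq : 2 ≤ q) (hK : Fintype.card K = q ^ 6)
    (hn : (n : ℤ) = (q : ℤ) ^ 8 - (q : ℤ) ^ 6 + (q : ℤ) ^ 5 - (q : ℤ) ^ 3)
    (S : ℤ) (hS0 : 0 ≤ S) (hS : S < n) {θ : ℝ} (hθ : 1 ≤ θ)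
    (h : 6 * k * Real.log q + ((q : ℝ) ^ 2 * θ + θ ^ 8 / (8 * (q : ℝ) ^ 4)) <
      (S + 1) * Real.log θ)
    {r₁ r₂ r₃ : ℕ} (h₁ : 2 ≤ r₁) (h₂ : 2 ≤ r₂) (h₃ : 2 ≤ r₃) (hr : r₁ + r₂ + r₃ < n) :
    ∃ C : Submodule K (Fin n → K), IsRecoverableCode C (k : ℤ) ((n : ℤ) - S) ![r₁, r₂, r₃] := by
  obtain ⟨N, hN⟩ := eight_dvd_length hn
  have hle : ((8 * N : ℕ) : ℝ) ≤ (q : ℝ) ^ 8 := by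
    rw [← hN]
    exact_mod_cast length_le_pow_eight hq hn
  push_cast at hle
  lift S to ℕ using hS0
  have hq0 : (0 : ℝ) < q := by exact_mod_cast (by omega : 0 < q)
  refine exists_isRecoverableCode_random_lines (N := N) (T := S + 1) (by omega) ?_ S hS hθ (by simp)
    (pow_mul_exp_lt_pow Fintype.card_pos (by linarith)
      (lt_of_le_of_lt ?_ (h.trans_eq (by push_cast; ring)))) h₁ h₂ h₃ hr
  · rw [hK]
    calc 8 ≤ 2 ^ 6 := by norm_num
      _ ≤ q ^ 6 := Nat.pow_le_pow_left hq 6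
  have h1 : (N : ℝ) * (8 * θ / Fintype.card K + θ ^ 8 / (Fintype.card K : ℝ) ^ 2) ≤
      (q : ℝ) ^ 2 * θ + θ ^ 8 / (8 * (q : ℝ) ^ 4) := by
    rw [hK]
    push_cast
    have e1 : (N : ℝ) * (8 * θ / (q : ℝ) ^ 6 + θ ^ 8 / ((q : ℝ) ^ 6) ^ 2) =
        (8 * N) * (θ / (q : ℝ) ^ 6 + θ ^ 8 / (8 * (q : ℝ) ^ 12)) := by
      field_simp
    have e2 : (q : ℝ) ^ 2 * θ + θ ^ 8 / (8 * (q : ℝ) ^ 4) =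
        (q : ℝ) ^ 8 * (θ / (q : ℝ) ^ 6 + θ ^ 8 / (8 * (q : ℝ) ^ 12)) := by
      field_simp
    rw [e1, e2]
    gcongr
  have h2 : (k : ℝ) * Real.log (Fintype.card K) = 6 * k * Real.log q := by
    rw [hK]
    push_cast
    rw [Real.log_pow]
    push_cast
    ring
  linarith

/-- The choice `θ = √q`. -/
theorem exists_isRecoverableCode_of_sqrt (hq : 2 ≤ q) (hK : Fintype.card K = q ^ 6)
    (hn : (n : ℤ) = (q : ℤ) ^ 8 - (q : ℤ) ^ 6 + (q : ℤ) ^ 5 - (q : ℤ) ^ 3)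
    (S : ℤ) (hS0 : 0 ≤ S) (hS : S < n) {μ : ℝ} (hμ : 2 ≤ μ * Real.log q)
    (h : 12 * k + μ * ((q : ℝ) ^ 2 * √q + 1 / 8) < S + 1)
    {r₁ r₂ r₃ : ℕ} (h₁ : 2 ≤ r₁) (h₂ : 2 ≤ r₂) (h₃ : 2 ≤ r₃) (hr : r₁ + r₂ + r₃ < n) :
    ∃ C : Submodule K (Fin n → K), IsRecoverableCode C (k : ℤ) ((n : ℤ) - S) ![r₁, r₂, r₃] := by
  have hq0 : (0 : ℝ) < q := by exact_mod_cast (by omega : 0 < q)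
  have hq1 : (1 : ℝ) < q := by exact_mod_cast (by omega : 1 < q)
  have hlog : 0 < Real.log q := Real.log_pos hq1
  refine exists_isRecoverableCode_of_log_lt_of_two_le hq hK hn S hS0 hS (θ := √q)
    (Real.one_le_sqrt.mpr hq1.le) ?_ h₁ h₂ h₃ hr
  -- At `θ = √q` the contribution of entirely vanishing lines is the constant `1 / 8`. Dividing the
  -- condition by `log q / 2` gives the hypothesis with `μ`.
  have h8 : (√(q : ℝ)) ^ 8 = (q : ℝ) ^ 4 := by
    calc (√(q : ℝ)) ^ 8 = ((√(q : ℝ)) ^ 2) ^ 4 := by ring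
      _ = _ := by rw [Real.sq_sqrt hq0.le]
  have h9 : (q : ℝ) ^ 4 / (8 * (q : ℝ) ^ 4) = 1 / 8 := by field_simp
  rw [h8, h9, Real.log_sqrt hq0.le]
  have hE : 0 ≤ (q : ℝ) ^ 2 * √q + 1 / 8 := by positivity
  nlinarith [mul_le_mul_of_nonneg_right hμ hE, mul_lt_mul_of_pos_right h hlog]

end

/-! ### Numerical verification by the size of `q` -/

/-- The case `a = 2`, where `N = 0` and only equal columns are available. If Reed–Solomon fails, `M`
is too large for `hM` when `q` is 2 or 4; `q = 8` is delicate, and from 16 on `φ = q` works with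
room. -/
theorem exists_isRecoverableCode_of_two_pow {K : Type*} [Field K] [Fintype K] [DecidableEq K]
    {n q ℓ M : ℕ} (hℓ : 1 ≤ ℓ) (hq : q = 2 ^ ℓ) (hK : Fintype.card K = q ^ 6)
    (hn : (n : ℤ) = (q : ℤ) ^ 8 - (q : ℤ) ^ 6 + (q : ℤ) ^ 5 - (q : ℤ) ^ 3)
    (S : ℤ) (hS : S < n) (hM : (M + 2) * (M + 3) ≤ q ^ 3 + 1)
    (hS₁ : (q : ℤ) ^ 3 + 1 + (M + 1) * q ≤ S) (hS₈ : q = 8 → 10 ≤ M → M ≤ 17 ∧ 713 ≤ S)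
    {r₁ r₂ r₃ : ℕ} (h₁ : 1 ≤ r₁) (h₂ : 1 ≤ r₂) (h₃ : 1 ≤ r₃) (hr : r₁ + r₂ + r₃ < n) :
    ∃ C : Submodule K (Fin n → K),
      IsRecoverableCode C ((M + 1 : ℕ) : ℤ) ((n : ℤ) - S) ![r₁, r₂, r₃] := by
  have hq2 : 2 ≤ q := hq ▸ Nat.le_self_pow (by omega) 2
  by_cases hRS : (M : ℤ) * (q : ℤ) ^ 2 ≤ S
  · refine exists_isRecoverableCode_of_sub_one_mul_le hq2 hK hn S hS ?_ h₁ h₂ h₃ hr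
    push_cast
    linarith
  · rw [not_le] at hRS
    have hcases : ℓ = 1 ∨ ℓ = 2 ∨ ℓ = 3 ∨ 4 ≤ ℓ := by omega
    rcases hcases with rfl | rfl | rfl | h4
    · norm_num at hq
      subst hq
      norm_num at *
      have : 6 ≤ M := by omega
      nlinarith
    · norm_num at hq
      subst hq
      norm_num at *
      have : 6 ≤ M := by omega
      nlinarith
    · norm_num at hq
      subst hq
      have h10 : 10 ≤ M := by
        norm_num at hRS hS₁
        omega
      obtain ⟨h17, hS7⟩ := hS₈ rfl h10
      -- `4 * 178 = 712 ≤ S`, and `φ = 11` leaves enough margin for `k ≤ 18`.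
      refine exists_isRecoverableCode_of_log_lt_of_one_le hq2 hK hn S hS (φ := 11) (T := 179)
        (by norm_num) (by push_cast; omega) ?_ h₁ h₂ h₃ hr
      have hlog8 : Real.log ((8 : ℕ) : ℝ) = 3 * Real.log 2 := by
        rw [show ((8 : ℕ) : ℝ) = 2 ^ 3 by norm_num, Real.log_pow]
        norm_num
      have hlog11 : 17 * Real.log 2 ≤ 5 * Real.log 11 := by
        have := Real.log_le_log (x := 2 ^ 17) (y := 11 ^ 5) (by norm_num) (by norm_num)
        rw [Real.log_pow, Real.log_pow] at this
        exact_mod_cast this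
      have hM17 : (M : ℝ) ≤ 17 := by exact_mod_cast h17
      have hl2 := Real.log_two_gt_d9
      rw [hlog8]
      push_cast
      nlinarith
    · have hq16 : 16 ≤ q := by
        rw [hq]
        exact Nat.pow_le_pow_right (n := 2) (by norm_num) h4
      have hS0 : 0 ≤ S := le_trans (by positivity) hS₁
      lift S to ℕ using hS0
      refine exists_isRecoverableCode_of_log_lt_of_one_le hq2 hK hn S hS (φ := q) (T := S / 4 + 1)
        (by exact_mod_cast hq2.trans' (by norm_num)) (by push_cast; omega) ?_ h₁ h₂ h₃ hr
      have hq16' : (16 : ℝ) ≤ q := by exact_mod_cast hq16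
      have hlog : 2 ≤ Real.log q := by
        have h16 : Real.log 16 = 4 * Real.log 2 := by
          rw [show (16 : ℝ) = 2 ^ 4 by norm_num, Real.log_pow]
          norm_num
        have := Real.log_le_log (by norm_num) hq16'
        linarith [Real.log_two_gt_d9]
      have hT : (q : ℝ) ^ 3 < 4 * ((S / 4 + 1 : ℕ) : ℝ) := by
        have : q ^ 3 < 4 * (S / 4 + 1) := by
          zify
          have : (0 : ℤ) ≤ (M + 1) * q := by positivity
          omega
        exact_mod_cast this
      have hk : 48 * ((M + 1 : ℕ) : ℝ) ≤ (q : ℝ) ^ 3 := by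
        have : 48 * (M + 1) ≤ q ^ 3 := by
          have h3 : 16 ^ 3 ≤ q ^ 3 := Nat.pow_le_pow_left hq16 3
          by_cases hM48 : M + 1 ≤ 48
          · omega
          · nlinarith
        exact_mod_cast this
      generalize ((S / 4 + 1 : ℕ) : ℝ) = T at hT
      generalize ((M + 1 : ℕ) : ℝ) = k at hk
      have h1 : (6 * k + (q : ℝ) ^ 3 / 8) * Real.log q < T * Real.log q := by
        apply mul_lt_mul_of_pos_right _ (by linarith)
        linarith
      have h2 : (q : ℝ) ^ 3 / 8 * 2 ≤ (q : ℝ) ^ 3 / 8 * Real.log q := by gcongr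
      nlinarith

theorem exists_isRecoverableCode_of_eight_le {K : Type*} [Field K] [Fintype K] [DecidableEq K]
    {n q s M N : ℕ} (hq : 8 ≤ q) (hK : Fintype.card K = q ^ 6)
    (hn : (n : ℤ) = (q : ℤ) ^ 8 - (q : ℤ) ^ 6 + (q : ℤ) ^ 5 - (q : ℤ) ^ 3)
    (S : ℤ) (hS : S < n) (hM : (M + 2) * (M + 3) ≤ q ^ 3 + 1) (hs : 1 ≤ s) (hN : N ≤ s)
    (hs₁ : s = 1 → 9 ≤ q) (hS₁ : (s : ℤ) * ((q : ℤ) ^ 3 + 1) + M * q ≤ S)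
    {r₁ r₂ r₃ : ℕ} (h₁ : 2 ≤ r₁) (h₂ : 2 ≤ r₂) (h₃ : 2 ≤ r₃) (hr : r₁ + r₂ + r₃ < n) :
    ∃ C : Submodule K (Fin n → K),
      IsRecoverableCode C (((M + 1) * (N + 1) : ℕ) : ℤ) ((n : ℤ) - S) ![r₁, r₂, r₃] := by
  have hq8 : (8 : ℝ) ≤ q := by exact_mod_cast hq
  have hS0 : 0 ≤ S := le_trans (by positivity) hS₁
  refine exists_isRecoverableCode_of_sqrt (by omega) hK hn S hS0 hS (μ := 1) ?_ ?_ h₁ h₂ h₃ hr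
  · have h8 : Real.log 8 = 3 * Real.log 2 := by
      rw [show (8 : ℝ) = 2 ^ 3 by norm_num, Real.log_pow]
      norm_num
    have := Real.log_le_log (by norm_num) hq8
    linarith [Real.log_two_gt_d9]
  · set x := √(q : ℝ) with hx
    have hx2 : (q : ℝ) = x ^ 2 := (Real.sq_sqrt (by positivity)).symm
    have hx0 : 0 ≤ x := Real.sqrt_nonneg _
    have hS₁' : (s : ℝ) * ((q : ℝ) ^ 3 + 1) + M * q ≤ S := by exact_mod_cast hS₁
    have hM' : ((M : ℝ) + 2) * (M + 3) ≤ (q : ℝ) ^ 3 + 1 := by exact_mod_cast hM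
    have hN' : (N : ℝ) ≤ s := by exact_mod_cast hN
    have hM0 : (0 : ℝ) ≤ M := by positivity
    -- `(M + 2) ^ 2 + (M + 2) ≤ q ^ 3 + 1` gives `(M + 2) ^ 2 ≤ x ^ 6`.
    have hMx : (M : ℝ) + 2 ≤ x ^ 3 := by
      refine (sq_le_sq₀ (by positivity) (by positivity)).mp ?_
      rw [hx2] at hM'
      nlinarith
    have hx28 : (2.82 : ℝ) ≤ x := Real.le_sqrt_of_sq_le (by norm_num; linarith)
    push_cast
    have hkN : ((M : ℝ) + 1) * (N + 1) ≤ (M + 1) * (s + 1) := by gcongr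
    rw [hx2] at hS₁' ⊢
    suffices h : 12 * (((M : ℝ) + 1) * (s + 1)) + 1 * ((x ^ 2) ^ 2 * x + 1 / 8) <
        s * ((x ^ 2) ^ 3 + 1) + M * x ^ 2 + 1 by linarith
    by_cases hs1 : s = 1
    · have h9 : (3 : ℝ) ≤ x := by
        apply Real.le_sqrt_of_sq_le
        norm_num
        exact_mod_cast hs₁ hs1
      rw [hs1]
      push_cast
      have key : (M : ℝ) * (24 - x ^ 2) ≤ 15 * (x ^ 3 - 2) := by
        calc (M : ℝ) * (24 - x ^ 2) ≤ M * 15 := by gcongr; nlinarith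
          _ ≤ 15 * (x ^ 3 - 2) := by linarith
      have h4 : 0 ≤ x ^ 3 * (x ^ 3 - x ^ 2 - 15) := by
        have : 0 ≤ x ^ 2 * (x - 1) - 15 := by nlinarith
        apply mul_nonneg (by positivity)
        linarith
      nlinarith
    -- For `s ≥ 2` the factor `s + 1` is at most `3 s / 2`, so everything becomes proportional to
    -- `s`.
    · have hs2 : (2 : ℝ) ≤ s := by exact_mod_cast (by omega : 2 ≤ s)
      have h5 : 0 ≤ x ^ 2 * (x - 1 / 2) - 18 := by nlinarith
      have h6 : 0 ≤ x ^ 3 * (x ^ 3 - x ^ 2 / 2 - 18) := by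
        apply mul_nonneg (by positivity)
        linarith
      have h7 : 12 * (((M : ℝ) + 1) * (s + 1)) ≤ s * (18 * (x ^ 3 - 1)) := by
        calc 12 * (((M : ℝ) + 1) * (s + 1)) ≤ 12 * ((x ^ 3 - 1) * (s + s / 2)) := by
              gcongr
              · nlinarith
              · linarith
              · linarith
          _ = s * (18 * (x ^ 3 - 1)) := by ring
      have h8 : x ^ 5 ≤ s * (x ^ 5 / 2) := by
        have : 0 ≤ x ^ 5 := by positivity
        nlinarith
      have h9 : 0 ≤ (s : ℝ) * (x ^ 3 * (x ^ 3 - x ^ 2 / 2 - 18)) := by positivity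
      have h10 : 0 ≤ (M : ℝ) * x ^ 2 := by positivity
      nlinarith

theorem exists_isRecoverableCode_of_eq_seven {K : Type*} [Field K] [Fintype K] [DecidableEq K]
    {n M N : ℕ} (hK : Fintype.card K = 7 ^ 6)
    (hn : (n : ℤ) = (7 : ℕ) ^ 8 - (7 : ℕ) ^ 6 + (7 : ℕ) ^ 5 - (7 : ℕ) ^ 3)
    (S : ℤ) (hS : S < n) (hM : M ≤ 16) (hN : N ≤ 5) (hS₁ : 1720 ≤ S)
    {r₁ r₂ r₃ : ℕ} (h₁ : 2 ≤ r₁) (h₂ : 2 ≤ r₂) (h₃ : 2 ≤ r₃) (hr : r₁ + r₂ + r₃ < n) :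
    ∃ C : Submodule K (Fin n → K),
      IsRecoverableCode C (((M + 1) * (N + 1) : ℕ) : ℤ) ((n : ℤ) - S) ![r₁, r₂, r₃] := by
  refine exists_isRecoverableCode_of_sqrt (q := 7) (by norm_num) hK hn S (by omega) hS (μ := 2)
    ?_ ?_ h₁ h₂ h₃ hr
  · have h1 : Real.log 4 = 2 * Real.log 2 := by
      rw [show (4 : ℝ) = 2 ^ 2 by norm_num, Real.log_pow]
      norm_num
    have := Real.log_le_log (x := 4) (y := ((7 : ℕ) : ℝ)) (by norm_num) (by norm_num)
    linarith [Real.log_two_gt_d9]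
  · have hx : √((7 : ℕ) : ℝ) ≤ 2.7 := Real.sqrt_le_iff.mpr (by norm_num)
    have hk : (((M + 1) * (N + 1) : ℕ) : ℝ) ≤ 102 := by
      have : (M + 1) * (N + 1) ≤ 17 * 6 := Nat.mul_le_mul (by omega) (by omega)
      exact_mod_cast this
    have hS' : (1720 : ℝ) ≤ S := by exact_mod_cast hS₁
    norm_num at hx hk ⊢
    linarith

theorem exists_isRecoverableCode_of_eq_five {K : Type*} [Field K] [Fintype K] [DecidableEq K]
    {n M N : ℕ} (hK : Fintype.card K = 5 ^ 6)
    (hn : (n : ℤ) = (5 : ℕ) ^ 8 - (5 : ℕ) ^ 6 + (5 : ℕ) ^ 5 - (5 : ℕ) ^ 3)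
    (S : ℤ) (hS : S < n) (hM : M ≤ 5) (hN : N ≤ 3) (hS₁ : 378 ≤ S)
    {r₁ r₂ r₃ : ℕ} (h₁ : 2 ≤ r₁) (h₂ : 2 ≤ r₂) (h₃ : 2 ≤ r₃) (hr : r₁ + r₂ + r₃ < n) :
    ∃ C : Submodule K (Fin n → K),
      IsRecoverableCode C (((M + 1) * (N + 1) : ℕ) : ℤ) ((n : ℤ) - S) ![r₁, r₂, r₃] := by
  refine exists_isRecoverableCode_of_sqrt (q := 5) (by norm_num) hK hn S (by omega) hS
    (μ := 3 / 2) ?_ ?_ h₁ h₂ h₃ hr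
  · have := Real.log_le_log (x := 2 ^ 2) (y := ((5 : ℕ) : ℝ)) (by norm_num) (by norm_num)
    rw [Real.log_pow] at this
    push_cast at this
    linarith [Real.log_two_gt_d9]
  · have hx : √((5 : ℕ) : ℝ) ≤ 2.24 := Real.sqrt_le_iff.mpr (by norm_num)
    have hk : (((M + 1) * (N + 1) : ℕ) : ℝ) ≤ 24 := by
      have : (M + 1) * (N + 1) ≤ 6 * 4 := Nat.mul_le_mul (by omega) (by omega)
      exact_mod_cast this
    have hS' : (378 : ℝ) ≤ S := by exact_mod_cast hS₁
    norm_num at hx hk ⊢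
    linarith

/-- For `k = 12` and `S = 174` the choice `θ = √q = 2` is not sufficient; `θ = 4` is. -/
theorem exists_isRecoverableCode_of_eq_four {K : Type*} [Field K] [Fintype K] [DecidableEq K]
    {n M : ℕ} (hK : Fintype.card K = 4 ^ 6)
    (hn : (n : ℤ) = (4 : ℕ) ^ 8 - (4 : ℕ) ^ 6 + (4 : ℕ) ^ 5 - (4 : ℕ) ^ 3)
    (S : ℤ) (hS : S < n) (hM : M ≤ 3) (hS₁ : 174 ≤ S)
    {r₁ r₂ r₃ : ℕ} (h₁ : 2 ≤ r₁) (h₂ : 2 ≤ r₂) (h₃ : 2 ≤ r₃) (hr : r₁ + r₂ + r₃ < n) :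
    ∃ C : Submodule K (Fin n → K),
      IsRecoverableCode C (((M + 1) * (2 + 1) : ℕ) : ℤ) ((n : ℤ) - S) ![r₁, r₂, r₃] := by
  refine exists_isRecoverableCode_of_log_lt_of_two_le (q := 4) (by norm_num) hK hn S (by omega) hS
    (θ := 4) (by norm_num) ?_ h₁ h₂ h₃ hr
  have h1 : Real.log 4 = 2 * Real.log 2 := by
    rw [show (4 : ℝ) = 2 ^ 2 by norm_num, Real.log_pow]
    norm_num
  have hM' : (M : ℝ) ≤ 3 := by exact_mod_cast hM
  have hS' : (174 : ℝ) ≤ S := by exact_mod_cast hS₁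
  have hl := Real.log_two_gt_d9
  push_cast
  rw [h1]
  have h2 : ((S : ℝ) + 1) * (2 * Real.log 2) ≥ 175 * (2 * Real.log 2) := by
    gcongr
    linarith
  have h3 : 6 * (((M : ℝ) + 1) * (2 + 1)) * (2 * Real.log 2) ≤ 72 * (2 * Real.log 2) := by
    gcongr
    linarith
  norm_num at h2 h3 ⊢
  linarith

/-! ### Arithmetic of the orders and assembly of the cases -/

/-- `q ^ 2 - q + 1` divides `q ^ 3 + 1`, so both orders do, and by coprimality so does their
product. This is what keeps `M` near `q ^ (3/2)`. -/
theorem mul_le_pow_three_add_one {q e o : ℕ} (he : e ∣ q ^ 3 + 1)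
    (ho : (o : ℤ) ∣ (q : ℤ) ^ 2 - (q : ℤ) + 1) (heo : Nat.Coprime e o) :
    o ∣ q ^ 3 + 1 ∧ e * o ≤ q ^ 3 + 1 := by
  have h1 : o ∣ q ^ 3 + 1 := by
    have : (o : ℤ) ∣ (q : ℤ) ^ 3 + 1 := by
      rw [show (q : ℤ) ^ 3 + 1 = ((q : ℤ) ^ 2 - q + 1) * (q + 1) by ring]
      exact ho.mul_right _
    exact_mod_cast this
  exact ⟨h1, Nat.le_of_dvd (by positivity) (heo.mul_dvd_of_dvd_of_dvd he h1)⟩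

theorem exists_isRecoverableCode_of_orders {K : Type*} [Field K] [Fintype K] [DecidableEq K]
    {p ℓ h q a n e o M N : ℕ} (hp : p.Prime) (hq : q = p ^ ℓ) (hh : 1 ≤ h) (hhℓ : h ≤ ℓ)
    (ha : a = p ^ h) (hK : Fintype.card K = q ^ 6)
    (hn : (n : ℤ) = (q : ℤ) ^ 8 - (q : ℤ) ^ 6 + (q : ℤ) ^ 5 - (q : ℤ) ^ 3)
    (he : e ∣ q ^ 3 + 1) (ho : (o : ℤ) ∣ (q : ℤ) ^ 2 - (q : ℤ) + 1) (heo : Nat.Coprime e o)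
    (S : ℤ) (hS : S < n) (hN : N + 2 ≤ a) (hMe : M + 2 ≤ e) (hMo : M + 2 ≤ o)
    (hS₁ : ((a : ℤ) - 2) * ((q : ℤ) ^ 3 + 1) + M * q ≤ S)
    (hSe : max (N : ℤ) 1 * ((q : ℤ) ^ 3 + 1) + ((e : ℤ) - 2) * q ≤ S)
    (hSo : max (N : ℤ) 1 * ((q : ℤ) ^ 3 + 1) + ((o : ℤ) - 2) * q ≤ S)
    (hr : (a - 1) + (e - 1) + (o - 1) < n) :
    ∃ C : Submodule K (Fin n → K),
      IsRecoverableCode C (((M + 1) * (N + 1) : ℕ) : ℤ) ((n : ℤ) - S) ![a - 1, e - 1, o - 1] := by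
  have hp2 := hp.two_le
  have hq2 : 2 ≤ q := by
    rw [hq]
    exact hp2.trans (Nat.le_self_pow (by omega) p)
  have hq0 : (0 : ℤ) < q := by omega
  obtain ⟨ho', hprod⟩ := mul_le_pow_three_add_one he ho heo
  have hne : e ≠ o := by
    rintro rfl
    rw [Nat.coprime_self] at heo
    omega
  have hM : (M + 2) * (M + 3) ≤ q ^ 3 + 1 := by
    refine le_trans ?_ hprod
    rcases Nat.lt_or_gt_of_ne hne with h' | h'
    · exact Nat.mul_le_mul hMe (by omega)
    · rw [mul_comm]
      exact Nat.mul_le_mul (by omega) hMo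
  have hRS : ((((M + 1) * (N + 1) : ℕ) : ℤ) - 1) * (q : ℤ) ^ 2 ≤ S →
      ∃ C : Submodule K (Fin n → K), IsRecoverableCode C (((M + 1) * (N + 1) : ℕ) : ℤ)
        ((n : ℤ) - S) ![a - 1, e - 1, o - 1] := fun hk =>
    exists_isRecoverableCode_of_sub_one_mul_le hq2 hK hn S hS hk (by omega) (by omega) (by omega) hr
  have hN1 : (N : ℤ) ≤ max (N : ℤ) 1 := le_max_left _ _
  have h11 : (1 : ℤ) ≤ max (N : ℤ) 1 := le_max_right _ _
  have hq3 : (0 : ℤ) < (q : ℤ) ^ 3 + 1 := by positivity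
  have hSN : (N : ℤ) * ((q : ℤ) ^ 3 + 1) ≤ S := by
    have : 0 ≤ ((e : ℤ) - 2) * q := mul_nonneg (by omega) hq0.le
    linarith [mul_le_mul_of_nonneg_right hN1 hq3.le]
  have hS1e : (q : ℤ) ^ 3 + 1 + ((e : ℤ) - 2) * q ≤ S := by
    linarith [mul_le_mul_of_nonneg_right h11 hq3.le]
  have hS1o : (q : ℤ) ^ 3 + 1 + ((o : ℤ) - 2) * q ≤ S := by
    linarith [mul_le_mul_of_nonneg_right h11 hq3.le]
  rcases Nat.eq_zero_or_pos M with rfl | hM0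
  · apply hRS
    refine le_trans ?_ hSN
    push_cast
    have : (q : ℤ) ^ 2 ≤ (q : ℤ) ^ 3 + 1 :=
      (pow_le_pow_right₀ (by omega) (by norm_num : 2 ≤ 3)).trans (by omega)
    linarith [mul_le_mul_of_nonneg_left this (Int.natCast_nonneg N)]
  by_cases ha2 : a = 2
  · have hp' : p = 2 := (Nat.prime_dvd_prime_iff_eq hp Nat.prime_two).mp
      (by rw [← ha2, ha]; exact dvd_pow_self p (by omega))
    subst hp'
    have hN0 : N = 0 := by omega
    subst hN0
    -- The orders are distinct, so the larger one is at least `M + 3`.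
    have hS₁' : (q : ℤ) ^ 3 + 1 + (M + 1) * q ≤ S := by
      rcases Nat.lt_or_gt_of_ne hne with h' | h'
      · have : ((M : ℤ) + 1) * q ≤ ((o : ℤ) - 2) * q := by gcongr; omega
        linarith
      · have : ((M : ℤ) + 1) * q ≤ ((e : ℤ) - 2) * q := by gcongr; omega
        linarith
    have := exists_isRecoverableCode_of_two_pow (M := M) (by omega) hq hK hn S hS hM hS₁' ?_
      (r₁ := a - 1) (r₂ := e - 1) (r₃ := o - 1) (by omega) (by omega) (by omega) hr
    · simpa using this
    · rintro rfl hM10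
      -- For `q = 8` and `M ≥ 10` the only possible pair is `o = 19`, `e = 27`: hence `M ≤ 17` and
      -- `S ≥ 513 + 25 * 8 = 713`.
      have ho57 : o ∈ Nat.divisors 57 := by
        rw [Nat.mem_divisors]
        exact ⟨by norm_num at ho; exact_mod_cast ho, by norm_num⟩
      have he513 : e ∈ Nat.divisors 513 := by
        rw [Nat.mem_divisors]
        exact ⟨by simpa using he, by norm_num⟩
      have d57 : Nat.divisors 57 = {1, 3, 19, 57} := by decide +kernel
      have d513 : Nat.divisors 513 = {1, 3, 9, 19, 27, 57, 171, 513} := by decide +kernel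
      rw [d57] at ho57
      rw [d513] at he513
      simp only [mem_insert, mem_singleton] at ho57 he513
      norm_num at hS1e
      rcases ho57 with rfl | rfl | rfl | rfl <;>
        rcases he513 with rfl | rfl | rfl | rfl | rfl | rfl | rfl | rfl <;> omega
  · have ha3 : 3 ≤ a := by omega
    obtain ⟨s, rfl⟩ : ∃ s, a = s + 2 := ⟨a - 2, by omega⟩
    have hs1 : 1 ≤ s := by omega
    have haq : s + 2 ≤ q := by
      rw [ha, hq]
      exact Nat.pow_le_pow_right (by omega) hhℓ
    have hS₁' : (s : ℤ) * ((q : ℤ) ^ 3 + 1) + M * q ≤ S := by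
      push_cast at hS₁
      linarith
    have hpa : p ∣ s + 2 := ha ▸ dvd_pow_self p (by omega)
    have haq' : s + 2 ∣ q := by
      rw [ha, hq]
      exact pow_dvd_pow p hhℓ
    have hpq : ∀ r, r.Prime → r ∣ q → p = r := fun r hr hrq =>
      ((Nat.prime_dvd_prime_iff_eq hr hp).mp (hr.dvd_of_dvd_pow (hq ▸ hrq))).symm
    by_cases hq8 : 8 ≤ q
    · refine exists_isRecoverableCode_of_eight_le hq8 hK hn S hS hM hs1 (by omega) ?_ hS₁'
        (by omega) (by omega) (by omega) hr
      rintro rfl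
      by_contra hlt
      have : q = 8 := by omega
      subst this
      norm_num at haq'
    · have hdiv : ∀ {b : ℕ}, b ≠ 0 → (o : ℤ) ∣ (b : ℤ) → o ∈ Nat.divisors b := fun hb hd =>
        Nat.mem_divisors.mpr ⟨by exact_mod_cast hd, hb⟩
      have hqc : q = 3 ∨ q = 4 ∨ q = 5 ∨ q = 6 ∨ q = 7 := by omega
      rcases hqc with rfl | rfl | rfl | rfl | rfl
      · have hs : s = 1 := by omega
        subst hs
        have ho7 := hdiv (b := 7) (by norm_num) (by norm_num at ho; exact_mod_cast ho)
        have he28 : e ∈ Nat.divisors 28 := Nat.mem_divisors.mpr ⟨by simpa using he, by norm_num⟩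
        rw [show Nat.divisors 7 = {1, 7} by decide +kernel] at ho7
        rw [show Nat.divisors 28 = {1, 2, 4, 7, 14, 28} by decide +kernel] at he28
        simp only [mem_insert, mem_singleton] at ho7 he28
        have ho : o = 7 := by omega
        subst ho
        have hM2 : M ≤ 2 := by
          rcases he28 with rfl | rfl | rfl | rfl | rfl | rfl <;> omega
        norm_num at hS1o
        -- Here `S ≥ 28 + 5 * 3 = 43`, so Reed–Solomon, with multiplicity 9, reaches `k = 5` but not
        -- `k = 6`.
        by_cases h6 : M = 2 ∧ N = 1
        · obtain ⟨rfl, rfl⟩ := h6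
          exact exists_isRecoverableCode_hermitian_quotient (by simpa using hK)
            (by norm_num at hn; omega) S hS (by omega) (by omega) (by omega) (by omega) hr
        · apply hRS
          have : (M + 1) * (N + 1) ≤ 4 := by
            have : N ≤ 1 := by omega
            interval_cases N <;> omega
          push_cast at this ⊢
          have : ((M : ℤ) + 1) * (N + 1) ≤ 4 := by exact_mod_cast this
          linarith
      · have hs : s = 2 := by
          have : s = 1 ∨ s = 2 := by omega
          rcases this with rfl | rfl
          · norm_num at haq'
          · rfl
        subst hs
        have ho13 := hdiv (b := 13) (by norm_num) (by norm_num at ho; exact_mod_cast ho)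
        have he65 : e ∈ Nat.divisors 65 := Nat.mem_divisors.mpr ⟨by simpa using he, by norm_num⟩
        rw [show Nat.divisors 13 = {1, 13} by decide +kernel] at ho13
        rw [show Nat.divisors 65 = {1, 5, 13, 65} by decide +kernel] at he65
        simp only [mem_insert, mem_singleton] at ho13 he65
        have ho : o = 13 := by omega
        subst ho
        have hM3 : M ≤ 3 := by
          rcases he65 with rfl | rfl | rfl | rfl <;> omega
        by_cases hN2 : N = 2
        · subst hN2
          norm_num at hSo
          exact exists_isRecoverableCode_of_eq_four hK hn S hS hM3 hSo (by omega)
            (by omega) (by omega) hr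
        · apply hRS
          have : (M + 1) * (N + 1) ≤ 4 * 2 := Nat.mul_le_mul (by omega) (by omega)
          have : ((M : ℤ) + 1) * (N + 1) ≤ 8 := by exact_mod_cast this
          push_cast at hS₁' ⊢
          omega
      · have hs : s = 3 := by
          have := (Nat.dvd_prime Nat.prime_five).mp haq'
          omega
        subst hs
        have ho21 := hdiv (b := 21) (by norm_num) (by norm_num at ho; exact_mod_cast ho)
        rw [show Nat.divisors 21 = {1, 3, 7, 21} by decide +kernel] at ho21
        simp only [mem_insert, mem_singleton] at ho21
        have hM5 : M ≤ 5 := by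
          norm_num at hprod
          rcases ho21 with rfl | rfl | rfl | rfl <;> omega
        exact exists_isRecoverableCode_of_eq_five hK hn S hS hM5 (by omega)
          (by norm_num at hS₁'; omega) (by omega) (by omega) (by omega) hr
      · have h2 := hpq 2 (by norm_num) (by norm_num)
        have h3 := hpq 3 (by norm_num) (by norm_num)
        omega
      · have hs : s = 5 := by
          have := (Nat.dvd_prime (by norm_num : Nat.Prime 7)).mp haq'
          omega
        subst hs
        have hM16 : M ≤ 16 := by
          by_contra hlt
          have : 19 * 20 ≤ (M + 2) * (M + 3) := Nat.mul_le_mul (by omega) (by omega)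
          norm_num at hM
          omega
        exact exists_isRecoverableCode_of_eq_seven hK hn S hS hM16 (by omega)
          (by norm_num at hS₁'; omega) (by omega) (by omega) (by omega) hr

theorem add_lt_length {q : ℤ} (hq : 2 ≤ q) :
    q + (q ^ 3 + 1) + (q ^ 2 - q + 1) < q ^ 8 - q ^ 6 + q ^ 5 - q ^ 3 := by
  have h1 : q ^ 8 - q ^ 6 + q ^ 5 - q ^ 3 = q ^ 3 * (q ^ 2 - 1) * (q ^ 3 + 1) := by ring
  have h2 : (2 : ℤ) ^ 2 ≤ q ^ 2 := pow_le_pow_left₀ (by norm_num) hq 2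
  have h3 : (2 : ℤ) ^ 3 ≤ q ^ 3 := pow_le_pow_left₀ (by norm_num) hq 3
  have h4 : q ^ 2 ≤ q ^ 3 := pow_le_pow_right₀ (by omega) (by norm_num)
  have h5 : 8 * 3 ≤ q ^ 3 * (q ^ 2 - 1) := by
    apply mul_le_mul <;> linarith
  have h6 : 8 * 3 * (q ^ 3 + 1) ≤ q ^ 3 * (q ^ 2 - 1) * (q ^ 3 + 1) :=
    mul_le_mul_of_nonneg_right h5 (by linarith)
  linarith

theorem proposition4p4 (p ℓ h q a : ℕ) (hp : p.Prime) (hq : q = p ^ ℓ)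
    (hh : 1 ≤ h) (hhℓ : h ≤ ℓ) (ha : a = p ^ h)
    {K : Type*} [Field K] [DecidableEq K] (hK : Nat.card K = q ^ 6)
    (η ω : K) (hη : orderOf η ∣ q ^ 3 + 1)
    (hω : (orderOf ω : ℤ) ∣ (q : ℤ) ^ 2 - (q : ℤ) + 1)
    (hηω : Nat.gcd (orderOf η) (orderOf ω) = 1)
    (t₁ t₂ t₃ : ℤ)
    (ht₁ : 0 < t₁)
    (ht₁' : t₁ < (q : ℤ) ^ 2 * ((q : ℤ) ^ 2 - 1) * ((q : ℤ) ^ 3 + 1) - (q : ℤ) ^ 3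
      + 2 * (q : ℤ) ^ 2 - 1)
    (ht₂ : 0 < t₂) (ht₂' : t₂ < (q : ℤ) ^ 3 * ((q : ℤ) ^ 2 - 1) - (q : ℤ))
    (ht₃ : 0 < t₃) (ht₃' : t₃ < (q : ℤ) ^ 3 * ((q : ℤ) ^ 2 - 1) - 1)
    (N₁ M₁ S : ℤ)
    (hN₁ : N₁ = min ((a : ℤ) - 2) (min t₂ t₃))
    (hM₁ : M₁ = min t₁ (min ((orderOf η : ℤ) - 2) ((orderOf ω : ℤ) - 2)))
    (hS : S = max (((a : ℤ) - 2) * ((q : ℤ) ^ 3 + 1) + t₁ * (q : ℤ))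
      (max (t₂ * ((q : ℤ) ^ 3 + 1) + ((orderOf η : ℤ) - 2) * (q : ℤ))
        (t₃ * ((q : ℤ) ^ 3 + 1) + ((orderOf ω : ℤ) - 2) * (q : ℤ))))
    (n : ℕ) (hn : (n : ℤ) = (q : ℤ) ^ 8 - (q : ℤ) ^ 6 + (q : ℤ) ^ 5 - (q : ℤ) ^ 3) :
    ∃ C : Submodule K (Fin n → K),
      IsRecoverableCode C ((M₁ + 1) * (N₁ + 1)) ((n : ℤ) - S)
        ![a - 1, orderOf η - 1, orderOf ω - 1] := by
  generalize orderOf η = e at *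
  generalize orderOf ω = o at *
  have hp2 := hp.two_le
  have hq2 : 2 ≤ q := by
    rw [hq]
    exact hp2.trans (Nat.le_self_pow (by omega) p)
  have ha2 : 2 ≤ a := by
    rw [ha]
    exact hp2.trans (Nat.le_self_pow (by omega) p)
  have haq : a ≤ q := by
    rw [ha, hq]
    exact Nat.pow_le_pow_right (by omega) hhℓ
  have hfin : Finite K := Nat.finite_of_card_ne_zero (by rw [hK]; positivity)
  have := Fintype.ofFinite K
  have hK' : Fintype.card K = q ^ 6 := by rw [← hK, Nat.card_eq_fintype_card]
  have hq2z : (2 : ℤ) ≤ q := by exact_mod_cast hq2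
  have ha2z : (2 : ℤ) ≤ a := by exact_mod_cast ha2
  have haqz : (a : ℤ) ≤ q := by exact_mod_cast haq
  have he0 : 0 < e := Nat.pos_of_dvd_of_pos hη (by positivity)
  have heq : (e : ℤ) ≤ (q : ℤ) ^ 3 + 1 := by exact_mod_cast Nat.le_of_dvd (by positivity) hη
  have hoq : (o : ℤ) ≤ (q : ℤ) ^ 2 - q + 1 := Int.le_of_dvd (by nlinarith) hω
  have ho0 : 0 < o := by
    rcases Nat.eq_zero_or_pos o with rfl | h
    · rw [Nat.cast_zero, zero_dvd_iff] at hω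
      nlinarith
    · exact h
  have hq3 : (0 : ℤ) < (q : ℤ) ^ 3 + 1 := by positivity
  -- The upper bounds on the `tᵢ` serve to make the designed distance positive.
  have hSlt : S < n := by
    rw [hS, hn, max_lt_iff, max_lt_iff]
    refine ⟨?_, ?_, ?_⟩
    · have h1 : ((a : ℤ) - 2) * ((q : ℤ) ^ 3 + 1) ≤ ((q : ℤ) - 2) * ((q : ℤ) ^ 3 + 1) := by gcongr
      have h2 := mul_le_mul_of_nonneg_right (Int.le_sub_one_of_lt ht₁') (by omega : (0 : ℤ) ≤ q)
      linarith
    · have h1 := mul_le_mul_of_nonneg_right (Int.le_sub_one_of_lt ht₂') hq3.le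
      have h2 : ((e : ℤ) - 2) * q ≤ ((q : ℤ) ^ 3 + 1 - 2) * q := by gcongr
      linarith
    · have h1 := mul_le_mul_of_nonneg_right (Int.le_sub_one_of_lt ht₃') hq3.le
      have h2 : ((o : ℤ) - 2) * q ≤ ((q : ℤ) ^ 2 - q + 1 - 2) * q := by gcongr
      have h3 : (0 : ℤ) ≤ (q : ℤ) ^ 2 := by positivity
      linarith
  have hr : (a - 1) + (e - 1) + (o - 1) < n := by
    zify [he0, ho0, (by omega : 1 ≤ a)]
    rw [hn]
    linarith [add_lt_length hq2z]
  have hS₁ : ((a : ℤ) - 2) * ((q : ℤ) ^ 3 + 1) + t₁ * q ≤ S := hS ▸ le_max_left _ _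
  have hSe : t₂ * ((q : ℤ) ^ 3 + 1) + ((e : ℤ) - 2) * q ≤ S :=
    hS ▸ (le_max_left _ _).trans (le_max_right _ _)
  have hSo : t₃ * ((q : ℤ) ^ 3 + 1) + ((o : ℤ) - 2) * q ≤ S :=
    hS ▸ (le_max_right _ _).trans (le_max_right _ _)
  -- This happens when one of the orders is 1; the required dimension is then 0.
  by_cases hM0 : M₁ = -1
  · rw [hM0]
    simpa using exists_isRecoverableCode_zero S hSlt hr
  · obtain ⟨M, rfl⟩ : ∃ M : ℕ, M₁ = M := Int.eq_ofNat_of_zero_le (by omega)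
    obtain ⟨N, rfl⟩ : ∃ N : ℕ, N₁ = N := Int.eq_ofNat_of_zero_le (by omega)
    -- From here on `t₂` and `t₃` matter only through this lower bound, and `t₁` only through `M ≤
    -- t₁`.
    have hmax₂ : max (N : ℤ) 1 ≤ t₂ := by omega
    have hmax₃ : max (N : ℤ) 1 ≤ t₃ := by omega
    have := exists_isRecoverableCode_of_orders (M := M) (N := N) hp hq hh hhℓ ha hK' hn hη hω hηω S
      hSlt (by omega) (by omega) (by omega)
      (le_trans (by gcongr; omega) hS₁)
      (le_trans (by gcongr) hSe) (le_trans (by gcongr) hSo) hr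
    exact_mod_cast this
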